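/- Equip the plane $\mathbb{R}^2$ with the $\ell^\infty$ distance $d$, and let $\Delta=\{(x,x): x\in\mathbb{R}\}$ be the diagonal. For $p\in[1,\infty)$: - A persistence diagram is a finite multiset of points $(s,t)\in\mathbb{R}^2$ with $s<t$; $\mathcal{D}$ is the set of all persistence diagrams. A partial matching between $D_1,D_2\in\mathcal{D}$ is a bijection $f\colon B_1\to B_2$ between sub-multisets $B_1\subseteq D_1$, $B_2\subseteq D_2$ (repeated points being regarded as distinct elements), with cost $$\mathrm{cost}_p(f)=\Big(\sum_{x\in B_1} d(x,f(x))^p+\sum_{x\in D_1\setminus B_1} d(x,\Delta)^p+\sum_{x\in D_2\setminus B_2} d(x,\Delta)^p\Big)^{1/p},$$ and $W_p(D_1,D_2)$ is the infimum of $\mathrm{cost}_p(f)$ over all partial matchings $f$ between $D_1$ and $D_2$. - $\mathcal{P}_p(\mathbb{R}^2)$ is the set of Borel probability measures on $\mathbb{R}^2$ with finite $p$-th moment, with the distance $W_p(\alpha,\beta)=\big(\inf_\gamma\int d(x,y)^p\,\mathrm{d}\gamma(x,y)\big)^{1/p}$, where $\gamma$ ranges over the Borel probability measures on $\mathbb{R}^2\times\mathbb{R}^2$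 with marginals $\alpha$ and $\beta$. A metric space $(X,d_X)$ coarsely embeds into Hilbert space if there are a Hilbert space $H$, a map $f\colon X\to H$, and non-decreasing functions $\rho_1,\rho_2\colon[0,\infty)\to[0,\infty)$ with $\lim_{t\to\infty}\rho_1(t)=\infty$ such that $\rho_1(d_X(x,y))\le\|f(x)-f(y)\|\le\rho_2(d_X(x,y))$ for all $x,y\in X$. Theorem. For every $p\in[1,\infty)$, the space of persistence diagrams $(\mathcal{D},W_p)$ coarsely embeds into Hilbert space if and only if the Wasserstein space $(\mathcal{P}_p(\mathbb{R}^2),W_p)$ coarsely embeds into Hilbert space. -/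

import Mathlib

open MeasureTheory Filter
open scoped NNReal ENNReal

noncomputable section

/-- A map `f` between two sets with distance functions `dX`, `dY` is a coarse embedding if
`ρ₁ (dX x y) ≤ dY (f x) (f y) ≤ ρ₂ (dX x y)` for some non-decreasing
`ρ₁, ρ₂ : [0,∞) → [0,∞)` with `ρ₁ t → ∞` as `t → ∞`. -/
def IsCoarseEmbedding {X Y : Type*} (dX : X → X → ℝ≥0) (dY : Y → Y → ℝ≥0) (f : X → Y) : Prop :=
  ∃ ρ₁ ρ₂ : ℝ≥0 → ℝ≥0, Monotone ρ₁ ∧ Monotone ρ₂ ∧ Tendsto ρ₁ atTop atTop ∧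
    ∀ x y : X, ρ₁ (dX x y) ≤ dY (f x) (f y) ∧ dY (f x) (f y) ≤ ρ₂ (dX x y)

/-- `(X, dX)` admits a coarse embedding into some Hilbert space. -/
def CoarselyEmbedsIntoHilbert {X : Type} (dX : X → X → ℝ≥0) : Prop :=
  ∃ (H : Type) (_ : NormedAddCommGroup H) (_ : InnerProductSpace ℝ H) (_ : CompleteSpace H)
    (f : X → H), IsCoarseEmbedding dX (fun u v : H => nndist u v) f

/-- A persistence diagram: a finite multiset of points `(b, d)` of the plane with `b < d`.
The distance on `ℝ × ℝ` is Mathlib's, that is, the `ℓ^∞` distance. -/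
abbrev PersistenceDiagram : Type := Multiset {x : ℝ × ℝ // x.1 < x.2}

/-- The point of the plane underlying an element of `D`. The type `D.ToType` has one element for
each point of `D` counted with multiplicity. -/
def PersistenceDiagram.point {D : PersistenceDiagram} (x : D.ToType) : ℝ × ℝ := x.1.1

/-- A partial matching between `D₁` and `D₂`: parts `B₁ ⊆ D₁`, `B₂ ⊆ D₂` and a bijection
`B₁ → B₂` (repeated points count as distinct elements). -/
structure PartialMatching (D₁ D₂ : PersistenceDiagram) where
  B₁ : Finset D₁.ToType
  B₂ : Finset D₂.ToType
  f : B₁ ≃ B₂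

open Classical in
/-- The `p`-cost of a partial matching; unmatched points pay their distance to the diagonal. -/
def PartialMatching.cost {D₁ D₂ : PersistenceDiagram} (p : ℝ) (m : PartialMatching D₁ D₂) : ℝ≥0 :=
  (∑ x : m.B₁, nndist (PersistenceDiagram.point x.1) (PersistenceDiagram.point (m.f x).1) ^ p
    + ∑ x ∈ m.B₁ᶜ, Metric.infNndist (PersistenceDiagram.point x) (Set.diagonal ℝ) ^ p
    + ∑ y ∈ m.B₂ᶜ, Metric.infNndist (PersistenceDiagram.point y) (Set.diagonal ℝ) ^ p) ^ (1 / p)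

/-- The `p`-Wasserstein distance between persistence diagrams. -/
def PersistenceDiagram.wassersteinDist (p : ℝ) (D₁ D₂ : PersistenceDiagram) : ℝ≥0 :=
  ⨅ m : PartialMatching D₁ D₂, m.cost p

/-- Borel probability measures on the metric space `X` with finite `p`-th moment. -/
def WassersteinSpace (p : ℝ) (X : Type) [MetricSpace X] [MeasurableSpace X] [BorelSpace X] : Type :=
  {μ : ProbabilityMeasure X // ∃ x₀ : X, ∫⁻ x, edist x x₀ ^ p ∂(μ : Measure X) < ∞}

/-- The couplings of `α` and `β`: probability measures on `X × X` with marginals `α` and `β`. -/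
def couplings {X : Type} [MeasurableSpace X] (α β : ProbabilityMeasure X) :
    Set (ProbabilityMeasure (X × X)) :=
  {γ | (γ : Measure (X × X)).map Prod.fst = (α : Measure X) ∧
    (γ : Measure (X × X)).map Prod.snd = (β : Measure X)}

/-- The `p`-Wasserstein distance between measures with finite `p`-th moments. The infimum is
a finite number for such measures, so `toNNReal` loses nothing. -/
def WassersteinSpace.wassersteinDist (p : ℝ) {X : Type} [MetricSpace X] [MeasurableSpace X]
    [BorelSpace X] (α β : WassersteinSpace p X) : ℝ≥0 :=
  ((⨅ γ ∈ couplings α.1 β.1, ∫⁻ z, edist z.1 z.2 ^ p ∂(γ : Measure (X × X))) ^ (1 / p)).toNNReal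

end

open scoped Topology

/-! Coarse embeddability into Hilbert space depends only on finite subsets, provided the control
functions are uniform. Gram kernels of embeddings of finite subsets, centred at a base point,
converge along an ultrafilter to a positive semidefinite kernel, and this is again a Gram kernel. It
therefore suffices to map finite subsets of each space into the other with uniform control; no
global map is needed.

The link is optimal assignment. For uniform measures on `N` points, Birkhoff's theorem makes the
transport cost that of a permutation, and dilating the plane by `N ^ (1 / p)` removes the factor `1
/ N`. Diagrams differ from this only through the diagonal.

From diagrams to measures: each diagram of a finite set `F` is completed by the diagonal projections
of the points of the others, so that all have equally many points. A permutation then yields a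
partial matching of no larger cost, and a matching yields a permutation of at most twice the cost
(`wassersteinDist_le_spread`, `exists_perm_spread_le`).

From measures to diagrams: finitely many measures are approximated within `1` by uniform measures
with the same number of points. A translation far above the diagonal makes leaving points unmatched
useless, so the diagram distance is the transport distance (`wassersteinDist_liftedDiagram`), with
total additive error `2`. -/

noncomputable section

/-! ### Coarse embeddings into Hilbert space and finite subsets -/

/-- Every positive semidefinite real kernel is the Gram kernel of a map into a Hilbert space. -/
theorem exists_featureMap {X : Type} (G : X → X → ℝ) (hsymm : ∀ x y, G x y = G y x)
    (hpos : ∀ c : X →₀ ℝ, 0 ≤ c.sum fun x a => c.sum fun y b => a * b * G x y) :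
    ∃ (H : Type) (_ : NormedAddCommGroup H) (_ : InnerProductSpace ℝ H) (_ : CompleteSpace H)
      (f : X → H), ∀ x y, inner ℝ (f x) (f y) = G x y := by
  let K : Matrix X X (ℝ →L[ℝ] ℝ) := fun x y => G x y • 1
  have hK : K.PosSemidef := by
    have tfae := (RKHS.posSemidef_tfae (K := K)).out 0 2
    refine tfae.2 ⟨?_, fun c => ?_⟩
    · ext x y
      rw [Matrix.conjTranspose_apply]
      simp [K, hsymm x y]
    · refine (hpos c).trans_eq ?_
      simp only [Finsupp.sum, map_sum]
      refine Finset.sum_congr rfl fun x _ => Finset.sum_congr rfl fun y _ => ?_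
      simp [K, hsymm x y]
      ring
  have : Fact K.PosSemidef := ⟨hK⟩
  refine ⟨RKHS.OfKernel K, inferInstance, inferInstance, inferInstance,
    fun x => RKHS.kerFun (RKHS.OfKernel K) x 1, fun x y => ?_⟩
  rw [← RKHS.kernel_inner, RKHS.OfKernel.kernel_ofKernel]
  simp [K, hsymm x y]

/-- Coarse embeddability into Hilbert space is determined by the finite subsets, provided the
control functions are uniform. -/
theorem coarselyEmbedsIntoHilbert_of_forall_finset {X : Type} (dX : X → X → ℝ≥0)
    (ρ₁ ρ₂ : ℝ≥0 → ℝ≥0) (h₁ : Monotone ρ₁) (h₂ : Monotone ρ₂) (h₁' : Tendsto ρ₁ atTop atTop)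
    (h : ∀ F : Finset X, ∃ (H : Type) (_ : NormedAddCommGroup H) (_ : InnerProductSpace ℝ H)
      (f : X → H), ∀ x ∈ F, ∀ y ∈ F,
        ρ₁ (dX x y) ≤ nndist (f x) (f y) ∧ nndist (f x) (f y) ≤ ρ₂ (dX x y)) :
    CoarselyEmbedsIntoHilbert dX := by
  rcases isEmpty_or_nonempty X with hX | ⟨⟨o⟩⟩
  · exact ⟨ℝ, inferInstance, inferInstance, inferInstance, fun _ => 0, ρ₁, ρ₂, h₁, h₂, h₁',
      fun x => hX.elim x⟩
  choose H i₁ i₂ f hf using h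
  -- Centring at `o` bounds each Gram entry through `ρ₂`, independently of `F`. Along an ultrafilter
  -- finer than `atTop` all entries then converge at once, although the spaces `H F` vary.
  let g : Finset X → X → X → ℝ := fun F x y => inner ℝ (f F x - f F o) (f F y - f F o)
  let U : Ultrafilter (Finset X) := Ultrafilter.of atTop
  have hU : ∀ x : X, ∀ᶠ F in (U : Filter (Finset X)), x ∈ F := fun x =>
    Ultrafilter.of_le atTop (Filter.eventually_atTop.2 ⟨{x}, fun F hF => hF (by simp)⟩)
  have hlim : ∀ x y, ∃ l, Tendsto (fun F => g F x y) U (𝓝 l) := by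
    intro x y
    let C : ℝ := ρ₂ (dX x o) * ρ₂ (dX y o)
    have hC : ∀ᶠ F in (U : Filter (Finset X)), g F x y ∈ Set.Icc (-C) C := by
      filter_upwards [hU x, hU y, hU o] with F hx hy ho
      refine abs_le.1 ((abs_real_inner_le_norm _ _).trans ?_)
      rw [← dist_eq_norm, ← dist_eq_norm]
      have e₁ : dist (f F x) (f F o) ≤ ρ₂ (dX x o) := by
        rw [dist_nndist]; exact_mod_cast (hf F x hx o ho).2
      have e₂ : dist (f F y) (f F o) ≤ ρ₂ (dX y o) := by
        rw [dist_nndist]; exact_mod_cast (hf F y hy o ho).2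
      exact mul_le_mul e₁ e₂ dist_nonneg (by positivity)
    obtain ⟨l, -, hl⟩ := (isCompact_Icc (a := -C) (b := C)).ultrafilter_le_nhds
      (U.map fun F => g F x y) (by rw [le_principal_iff]; exact hC)
    exact ⟨l, hl⟩
  choose G hG using hlim
  obtain ⟨E, j₁, j₂, j₃, e, he⟩ := exists_featureMap G
    (fun x y => tendsto_nhds_unique (hG x y)
      ((hG y x).congr fun F => real_inner_comm _ _))
    (fun c => by
      refine ge_of_tendsto (x := (U : Filter (Finset X)))
        (f := fun F => c.sum fun x a => c.sum fun y b => a * b * g F x y) ?_ ?_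
      · exact tendsto_finsetSum _ fun x _ => tendsto_finsetSum _ fun y _ => (hG x y).const_mul _
      · refine Eventually.of_forall fun F => ?_
        have : (c.sum fun x a => c.sum fun y b => a * b * g F x y)
            = inner ℝ (c.sum fun x a => a • (f F x - f F o))
              (c.sum fun x a => a • (f F x - f F o)) := by
          simp only [Finsupp.sum, sum_inner, inner_sum, real_inner_smul_left,
            real_inner_smul_right, g]
          exact Finset.sum_congr rfl fun x _ => Finset.sum_congr rfl fun y _ => by
            rw [real_inner_comm]; ring
        rw [this]
        exact real_inner_self_nonneg)
  refine ⟨E, j₁, j₂, j₃, e, ρ₁, ρ₂, h₁, h₂, h₁', fun x y => ?_⟩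
  have hnorm : Tendsto (fun F => nndist (f F x) (f F y)) U (𝓝 (nndist (e x) (e y))) := by
    rw [← NNReal.tendsto_coe]
    simp only [coe_nndist]
    have hsq : Tendsto (fun F => dist (f F x) (f F y) ^ 2) U (𝓝 (dist (e x) (e y) ^ 2)) := by
      -- Distances are recovered from the Gram kernel by polarization, with `w` the base point: `f F
      -- o` before the limit and `0` after it.
      have key : ∀ {V : Type} [NormedAddCommGroup V] [InnerProductSpace ℝ V] (u v w : V),
          dist u v ^ 2 = inner ℝ (u - w) (u - w) - 2 * inner ℝ (u - w) (v - w)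
            + inner ℝ (v - w) (v - w) := by
        intro V _ _ u v w
        rw [dist_eq_norm, ← sub_sub_sub_cancel_right u v w, ← real_inner_self_eq_norm_sq,
          real_inner_sub_sub_self]
      have := ((hG x x).sub ((hG x y).const_mul 2)).add (hG y y)
      rw [key (e x) (e y) 0]
      simp only [sub_zero, he]
      exact this.congr fun F => (key _ _ _).symm
    simpa [Real.sqrt_sq dist_nonneg] using hsq.sqrt
  exact ⟨ge_of_tendsto hnorm (by filter_upwards [hU x, hU y] with F hx hy using (hf F x hx y hy).1),
    le_of_tendsto hnorm (by filter_upwards [hU x, hU y] with F hx hy using (hf F x hx y hy).2)⟩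

/-- If all finite subsets of `X` map to `Y` with uniform coarse control and `Y` coarsely embeds
into Hilbert space, then so does `X`. -/
theorem CoarselyEmbedsIntoHilbert.of_forall_finset {X Y : Type} {dX : X → X → ℝ≥0}
    {dY : Y → Y → ℝ≥0} (hY : CoarselyEmbedsIntoHilbert dY)
    (τ₁ τ₂ : ℝ≥0 → ℝ≥0) (h₁ : Monotone τ₁) (h₂ : Monotone τ₂) (h₁' : Tendsto τ₁ atTop atTop)
    (h : ∀ F : Finset X, ∃ φ : X → Y, ∀ x ∈ F, ∀ y ∈ F,
        τ₁ (dX x y) ≤ dY (φ x) (φ y) ∧ dY (φ x) (φ y) ≤ τ₂ (dX x y)) :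
    CoarselyEmbedsIntoHilbert dX := by
  obtain ⟨H, i₁, i₂, i₃, f, ρ₁, ρ₂, m₁, m₂, t₁, hf⟩ := hY
  refine coarselyEmbedsIntoHilbert_of_forall_finset dX (ρ₁ ∘ τ₁) (ρ₂ ∘ τ₂) (m₁.comp h₁)
    (m₂.comp h₂) (t₁.comp h₁') fun F => ?_
  obtain ⟨φ, hφ⟩ := h F
  exact ⟨H, i₁, i₂, f ∘ φ, fun x hx y hy =>
    ⟨(m₁ (hφ x hx y hy).1).trans (hf _ _).1, (hf _ _).2.trans (m₂ (hφ x hx y hy).2)⟩⟩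

/-! ### Wasserstein distance with extended values -/

/-- The Wasserstein distance of two probability measures, with values in `[0, ∞]`. -/
def wassersteinEDist (p : ℝ) {X : Type} [MetricSpace X] [MeasurableSpace X]
    (α β : ProbabilityMeasure X) : ℝ≥0∞ :=
  (⨅ γ ∈ couplings α β, ∫⁻ z, edist z.1 z.2 ^ p ∂(γ : Measure (X × X))) ^ (1 / p)

section Wasserstein

open ProbabilityTheory

/-- Two couplings with a common middle marginal are the marginals of one measure on triples. -/
theorem exists_gluing {X : Type} [MeasurableSpace X] [StandardBorelSpace X]
    {α β δ : ProbabilityMeasure X}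
    {γ₁ γ₂ : ProbabilityMeasure (X × X)} (h₁ : γ₁ ∈ couplings α β) (h₂ : γ₂ ∈ couplings β δ) :
    ∃ τ : ProbabilityMeasure ((X × X) × X),
      (τ : Measure ((X × X) × X)).map Prod.fst = (γ₁ : Measure (X × X)) ∧
      (τ : Measure ((X × X) × X)).map (fun t => (t.1.2, t.2)) = (γ₂ : Measure (X × X)) := by
  have : Nonempty X := α.nonempty
  let κ := (γ₂ : Measure (X × X)).condKernel
  -- The third coordinate is drawn from the disintegration of `γ₂` given the second one,
  -- conditionally independently of the first.
  let τ : Measure ((X × X) × X) :=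
    (γ₁ : Measure (X × X)) ⊗ₘ (κ.comap Prod.snd measurable_snd)
  refine ⟨⟨τ, inferInstance⟩, Measure.fst_compProd _ _, ?_⟩
  change τ.map (fun t => (t.1.2, t.2)) = _
  ext s hs
  have hm : Measurable fun t : (X × X) × X => (t.1.2, t.2) := by fun_prop
  have hfst : (γ₂ : Measure (X × X)).fst = (γ₁ : Measure (X × X)).map Prod.snd :=
    h₂.1.trans h₁.2.symm
  conv_rhs => rw [← (γ₂ : Measure (X × X)).disintegrate κ]
  rw [Measure.map_apply hm hs, Measure.compProd_apply (hm hs), Measure.compProd_apply hs, hfst,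
    lintegral_map (Kernel.measurable_kernel_prodMk_left hs) measurable_snd]
  rfl

variable {p : ℝ} {X : Type} [MetricSpace X] [MeasurableSpace X] {α β δ : ProbabilityMeasure X}

theorem wassersteinEDist_le_of_coupling (hp : 1 ≤ p) {γ : ProbabilityMeasure (X × X)}
    (hγ : γ ∈ couplings α β) :
    wassersteinEDist p α β ≤ (∫⁻ z, edist z.1 z.2 ^ p ∂(γ : Measure (X × X))) ^ (1 / p) :=
  ENNReal.rpow_le_rpow (iInf₂_le γ hγ) (by positivity)

theorem le_wassersteinEDist (hp : 1 ≤ p) {c : ℝ≥0∞}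
    (h : ∀ γ ∈ couplings α β, c ≤ (∫⁻ z, edist z.1 z.2 ^ p ∂(γ : Measure (X × X))) ^ (1 / p)) :
    c ≤ wassersteinEDist p α β := by
  have hp' : 0 < p := by linarith
  rw [wassersteinEDist, one_div, ENNReal.le_rpow_inv_iff hp']
  refine le_iInf₂ fun γ hγ => ?_
  rw [← ENNReal.le_rpow_inv_iff hp', ← one_div]
  exact h γ hγ

/-- The slack `c` lets the triangle inequality treat one coupling at a time, without optimal or
almost optimal couplings. -/
theorem wassersteinEDist_le_of_forall (hp : 1 ≤ p) {α' β' : ProbabilityMeasure X} {c : ℝ≥0∞}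
    (h : ∀ γ ∈ couplings α β,
      wassersteinEDist p α' β' ≤ (∫⁻ z, edist z.1 z.2 ^ p ∂(γ : Measure (X × X))) ^ (1 / p) + c) :
    wassersteinEDist p α' β' ≤ wassersteinEDist p α β + c := by
  rw [← tsub_le_iff_right]
  exact le_wassersteinEDist hp fun γ hγ => tsub_le_iff_right.2 (h γ hγ)

theorem wassersteinEDist_comm [OpensMeasurableSpace X] [SecondCountableTopology X] (hp : 1 ≤ p) :
    wassersteinEDist p α β = wassersteinEDist p β α := by
  suffices h : ∀ α β : ProbabilityMeasure X, wassersteinEDist p α β ≤ wassersteinEDist p β α from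
    le_antisymm (h α β) (h β α)
  intro α β
  refine le_wassersteinEDist hp fun γ hγ => ?_
  refine (wassersteinEDist_le_of_coupling hp
    (γ := γ.map (f := Prod.swap) measurable_swap.aemeasurable) ⟨?_, ?_⟩).trans_eq ?_
  · rw [ProbabilityMeasure.toMeasure_map, Measure.map_map measurable_fst measurable_swap]
    exact hγ.2
  · rw [ProbabilityMeasure.toMeasure_map, Measure.map_map measurable_snd measurable_swap]
    exact hγ.1
  · rw [ProbabilityMeasure.toMeasure_map, lintegral_map (by fun_prop) measurable_swap]
    simp [edist_comm]

/-- Glue the two couplings, project to the outer coordinates and apply Minkowski's inequality in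
`L^p`. -/
theorem wassersteinEDist_triangle [OpensMeasurableSpace X] [SecondCountableTopology X]
    [StandardBorelSpace X] (hp : 1 ≤ p) :
    wassersteinEDist p α δ ≤ wassersteinEDist p α β + wassersteinEDist p β δ := by
  refine wassersteinEDist_le_of_forall hp fun γ₁ h₁ => ?_
  rw [add_comm]
  refine wassersteinEDist_le_of_forall hp fun γ₂ h₂ => ?_
  obtain ⟨τ, t₁, t₂⟩ := exists_gluing h₁ h₂
  have hm : Measurable fun t : (X × X) × X => (t.1.1, t.2) := by fun_prop
  have hm₂ : Measurable fun t : (X × X) × X => (t.1.2, t.2) := by fun_prop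
  refine (wassersteinEDist_le_of_coupling hp (γ := τ.map (f := fun t => (t.1.1, t.2))
    hm.aemeasurable) ⟨?_, ?_⟩).trans ?_
  · rw [ProbabilityMeasure.toMeasure_map, Measure.map_map measurable_fst hm, ← h₁.1, ← t₁,
      Measure.map_map measurable_fst measurable_fst]
    rfl
  · rw [ProbabilityMeasure.toMeasure_map, Measure.map_map measurable_snd hm, ← h₂.2, ← t₂,
      Measure.map_map measurable_snd hm₂]
    rfl
  · rw [ProbabilityMeasure.toMeasure_map, lintegral_map (by fun_prop) hm, ← t₁, ← t₂,
      lintegral_map (by fun_prop) measurable_fst, lintegral_map (by fun_prop) hm₂, add_comm]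
    refine le_trans ?_ (ENNReal.lintegral_Lp_add_le (by fun_prop) (by fun_prop) hp)
    refine ENNReal.rpow_le_rpow (lintegral_mono fun t => ?_) (by positivity)
    exact ENNReal.rpow_le_rpow (edist_triangle _ _ _) (by positivity)

/-- The image of a measure under a map is at distance at most the `L^p` displacement. -/
theorem wassersteinEDist_map_le [OpensMeasurableSpace X] [SecondCountableTopology X] (hp : 1 ≤ p)
    {g : X → X} (hg : Measurable g) :
    wassersteinEDist p α (α.map (f := g) hg.aemeasurable)
      ≤ (∫⁻ x, edist x (g x) ^ p ∂(α : Measure X)) ^ (1 / p) := by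
  have hm : Measurable fun x => (x, g x) := by fun_prop
  refine (wassersteinEDist_le_of_coupling hp
    (γ := α.map (f := fun x => (x, g x)) hm.aemeasurable) ⟨?_, ?_⟩).trans_eq ?_
  · rw [ProbabilityMeasure.toMeasure_map, Measure.map_map measurable_fst hm]
    exact Measure.map_id
  · rw [ProbabilityMeasure.toMeasure_map, ProbabilityMeasure.toMeasure_map,
      Measure.map_map measurable_snd hm]
    rfl
  · rw [ProbabilityMeasure.toMeasure_map, lintegral_map (by fun_prop) hm]

theorem wassersteinEDist_dirac_lt_top [OpensMeasurableSpace X] [SecondCountableTopology X]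
    (hp : 1 ≤ p) {x₀ : X} (h : ∫⁻ x, edist x x₀ ^ p ∂(α : Measure X) < ∞) :
    wassersteinEDist p α (diracProba x₀) < ∞ := by
  have := wassersteinEDist_map_le (α := α) hp (measurable_const (a := x₀))
  have e : α.map (f := fun _ => x₀) measurable_const.aemeasurable
      = diracProba x₀ := by
    apply Subtype.ext
    change (α : Measure X).map (fun _ => x₀) = Measure.dirac x₀
    simp [Measure.map_const]
  rw [e] at this
  exact this.trans_lt (ENNReal.rpow_lt_top_of_nonneg (by positivity) h.ne)

theorem wassersteinEDist_self [OpensMeasurableSpace X] [SecondCountableTopology X]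
    (hp : 1 ≤ p) : wassersteinEDist p α α = 0 := by
  have := wassersteinEDist_map_le (α := α) hp measurable_id
  have e : α.map (f := id) measurable_id.aemeasurable = α :=
    Subtype.ext Measure.map_id
  have hp' : 0 < p := by linarith
  rw [e] at this
  simpa [hp'] using this

/-- Passing through Dirac masses reduces finiteness to the two moment conditions and the distance
between two points. -/
theorem wassersteinEDist_lt_top [BorelSpace X] [SecondCountableTopology X]
    [StandardBorelSpace X] (hp : 1 ≤ p) (α β : WassersteinSpace p X) :
    wassersteinEDist p α.1 β.1 < ∞ := by
  obtain ⟨x, hx⟩ := α.2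
  obtain ⟨y, hy⟩ := β.2
  refine (wassersteinEDist_triangle (β := diracProba x) hp).trans_lt
    (ENNReal.add_lt_top.2 ⟨wassersteinEDist_dirac_lt_top hp hx, ?_⟩)
  rw [wassersteinEDist_comm hp]
  refine (wassersteinEDist_triangle (β := diracProba y) hp).trans_lt
    (ENNReal.add_lt_top.2 ⟨wassersteinEDist_dirac_lt_top hp hy,
      wassersteinEDist_dirac_lt_top hp ?_⟩)
  change ∫⁻ x', edist x' x ^ p ∂(Measure.dirac y) < ∞
  rw [lintegral_dirac' _ (by fun_prop)]
  exact ENNReal.rpow_lt_top_of_nonneg (by positivity) (edist_ne_top _ _)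

theorem coe_wassersteinDist [BorelSpace X] [SecondCountableTopology X]
    [StandardBorelSpace X] (hp : 1 ≤ p) (α β : WassersteinSpace p X) :
    (WassersteinSpace.wassersteinDist p α β : ℝ≥0∞) = wassersteinEDist p α.1 β.1 :=
  ENNReal.coe_toNNReal (wassersteinEDist_lt_top hp α β).ne

end Wasserstein

/-! ### Birkhoff's theorem and transport between uniform measures -/

/-- A doubly stochastic average of a cost is at least the cost of some permutation. -/
theorem exists_perm_sum_le_of_mem_doublyStochastic {ι : Type*} [Fintype ι] [DecidableEq ι]
    {M : Matrix ι ι ℝ} (hM : M ∈ doublyStochastic ℝ ι) (c : ι → ι → ℝ) :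
    ∃ σ : Equiv.Perm ι, ∑ i, c i (σ i) ≤ ∑ i, ∑ j, M i j * c i j := by
  obtain ⟨w, hw, hw₁, rfl⟩ := exists_eq_sum_perm_of_mem_doublyStochastic hM
  obtain ⟨σ, -, hσ⟩ := Finset.exists_min_image (Finset.univ : Finset (Equiv.Perm ι))
    (fun σ => ∑ i, c i (σ i)) Finset.univ_nonempty
  refine ⟨σ, ?_⟩
  have key : ∑ i, ∑ j, (∑ τ, w τ • τ.permMatrix ℝ) i j * c i j
      = ∑ τ, w τ * ∑ i, c i (τ i) := by
    simp only [Matrix.sum_apply, Matrix.smul_apply, smul_eq_mul, Finset.sum_mul,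
      Equiv.Perm.permMatrix, PEquiv.toMatrix_apply, Equiv.toPEquiv_apply, Option.mem_def,
      Option.some.injEq, Finset.mul_sum]
    rw [Finset.sum_comm (s := Finset.univ (α := Equiv.Perm ι))]
    refine Finset.sum_congr rfl fun i _ => ?_
    rw [Finset.sum_comm]
    refine Finset.sum_congr rfl fun τ _ => ?_
    simp
  rw [key]
  calc ∑ i, c i (σ i) = ∑ τ, w τ * ∑ i, c i (σ i) := by rw [← Finset.sum_mul, hw₁, one_mul]
    _ ≤ _ := Finset.sum_le_sum fun τ _ =>
      mul_le_mul_of_nonneg_left (hσ τ (Finset.mem_univ _)) (hw τ)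

section Uniform

variable {X Y : Type} [MeasurableSpace X] [MeasurableSpace Y]
  {ι : Type*} [Fintype ι] [Nonempty ι]

/-- The uniform probability measure on a finite family of points. -/
def uniformMeasure (x : ι → X) : ProbabilityMeasure X :=
  ⟨(Fintype.card ι : ℝ≥0∞)⁻¹ • ∑ i, Measure.dirac (x i), ⟨by
    simp [ENNReal.inv_mul_cancel]⟩⟩

theorem toMeasure_uniformMeasure (x : ι → X) :
    (uniformMeasure x : Measure X) = (Fintype.card ι : ℝ≥0∞)⁻¹ • ∑ i, Measure.dirac (x i) := rfl

theorem uniformMeasure_comp_equiv {κ : Type*} [Fintype κ] [Nonempty κ] (e : κ ≃ ι) (x : ι → X) :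
    uniformMeasure (x ∘ e) = uniformMeasure x := by
  apply Subtype.ext
  change (Fintype.card κ : ℝ≥0∞)⁻¹ • ∑ k, Measure.dirac (x (e k))
    = (Fintype.card ι : ℝ≥0∞)⁻¹ • ∑ i, Measure.dirac (x i)
  rw [Fintype.card_congr e, e.sum_comp fun i => Measure.dirac (x i)]

theorem map_uniformMeasure {f : X → Y} (hf : Measurable f) (x : ι → X) :
    (uniformMeasure x : Measure X).map f = (uniformMeasure (f ∘ x) : Measure Y) := by
  simp [toMeasure_uniformMeasure, Measure.map_smul, Measure.map_finset_sum hf.aemeasurable,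
    Measure.map_dirac' hf]

theorem lintegral_uniformMeasure {f : X → ℝ≥0∞} (hf : Measurable f) (x : ι → X) :
    ∫⁻ a, f a ∂(uniformMeasure x : Measure X) = (Fintype.card ι : ℝ≥0∞)⁻¹ * ∑ i, f (x i) := by
  simp [toMeasure_uniformMeasure, lintegral_dirac' _ hf]

/-- Families may repeat points; dividing by the multiplicity makes a sum over indices count each
value once. -/
theorem sum_div_card_fiber {ι X : Type*} [Fintype ι] [DecidableEq X] (y : ι → X) (g : X → ℝ) :
    ∑ j, g (y j) / (Finset.univ.filter fun k => y k = y j).card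
      = ∑ b ∈ Finset.univ.image y, g b := by
  rw [Finset.sum_comp (fun b => g b / (Finset.univ.filter fun k => y k = b).card) y]
  refine Finset.sum_congr rfl fun b hb => ?_
  obtain ⟨j, -, rfl⟩ := Finset.mem_image.1 hb
  have : ((Finset.univ.filter fun k => y k = y j).card : ℝ) ≠ 0 := by
    exact Nat.cast_ne_zero.2 (Finset.card_ne_zero_of_mem (a := j) (by simp))
  rw [nsmul_eq_mul]
  field_simp

variable [MeasurableSingletonClass X]

open Classical in
theorem real_uniformMeasure_singleton (x : ι → X) (a : X) :
    (uniformMeasure x : Measure X).real {a}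
      = (Finset.univ.filter fun k => x k = a).card / Fintype.card ι := by
  have : ∀ k, (Measure.dirac (x k)) {a} = if x k = a then 1 else 0 := fun k => by
    simp [Set.indicator_apply]
  simp [Measure.real, toMeasure_uniformMeasure, this, div_eq_inv_mul]

theorem uniformMeasure_compl_range (x : ι → X) :
    (uniformMeasure x : Measure X) (Set.range x)ᶜ = 0 := by
  simp [toMeasure_uniformMeasure, Measure.dirac_apply' _ (Set.finite_range x).measurableSet.compl]

-- The second marginal gives no mass to the complement of the range of `y`, so summing the atoms
-- over the distinct values of `y` gives the first marginal at `x i`.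
open Classical in
theorem sum_coupling_div_card_fiber {x y : ι → X} {γ : ProbabilityMeasure (X × X)}
    (hγ : γ ∈ couplings (uniformMeasure x) (uniformMeasure y)) (i : ι) :
    ∑ j, (γ : Measure (X × X)).real {(x i, y j)} / (Finset.univ.filter fun k => y k = y j).card
      = (Finset.univ.filter fun k => x k = x i).card / Fintype.card ι := by
  rw [sum_div_card_fiber y fun b => (γ : Measure (X × X)).real {(x i, b)},
    ← real_uniformMeasure_singleton, ← hγ.1,
    map_measureReal_apply measurable_fst (measurableSet_singleton _)]
  have h₁ : ∑ b ∈ Finset.univ.image y, (γ : Measure (X × X)).real {(x i, b)}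
      = (γ : Measure (X × X)).real (((Finset.univ.image y).map
        ⟨fun b => (x i, b), Prod.mk_right_injective _⟩ : Finset (X × X)) : Set (X × X)) := by
    rw [← sum_measureReal_singleton, Finset.sum_map]
    rfl
  have h₀ : (γ : Measure (X × X)) (Prod.snd ⁻¹' (Set.range y)ᶜ) = 0 := by
    rw [← Measure.map_apply measurable_snd (Set.finite_range y).measurableSet.compl, hγ.2,
      uniformMeasure_compl_range]
  rw [h₁]
  refine measureReal_congr ?_
  have h₀' : ∀ᵐ z ∂(γ : Measure (X × X)), z.2 ∈ Set.range y := by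
    rw [ae_iff]; exact h₀
  filter_upwards [h₀'] with z hz
  obtain ⟨j, hj⟩ := hz
  apply propext
  constructor
  · intro h
    simp only [Finset.coe_map, Function.Embedding.coeFn_mk] at h
    obtain ⟨b, -, rfl⟩ := h
    rfl
  · intro h
    simp only [Finset.coe_map, Function.Embedding.coeFn_mk]
    exact ⟨z.2, by simp [← hj], Prod.ext (Eq.symm h) rfl⟩

end Uniform

section UniformDist

variable {p : ℝ} {X : Type} [MetricSpace X] [MeasurableSpace X] [BorelSpace X]
  [SecondCountableTopology X] {ι : Type*} [Fintype ι] [Nonempty ι]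

theorem wassersteinEDist_uniformMeasure_le (hp : 1 ≤ p) (x y : ι → X) (σ : Equiv.Perm ι) :
    wassersteinEDist p (uniformMeasure x) (uniformMeasure y)
      ≤ ((Fintype.card ι : ℝ≥0∞)⁻¹ * ∑ i, edist (x i) (y (σ i)) ^ p) ^ (1 / p) := by
  refine (wassersteinEDist_le_of_coupling hp (γ := uniformMeasure fun i => (x i, y (σ i)))
    ⟨?_, ?_⟩).trans_eq ?_
  · rw [map_uniformMeasure measurable_fst]
    rfl
  · rw [map_uniformMeasure measurable_snd, ← uniformMeasure_comp_equiv σ y]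
    rfl
  · rw [lintegral_uniformMeasure (by fun_prop)]

-- Splitting the mass of each atom evenly among the index pairs representing it, and multiplying by
-- `N`, gives a doubly stochastic matrix to which Birkhoff's theorem applies.
open Classical in
theorem exists_perm_le_lintegral (hp : 1 ≤ p) {x y : ι → X} {γ : ProbabilityMeasure (X × X)}
    (hγ : γ ∈ couplings (uniformMeasure x) (uniformMeasure y)) :
    ∃ σ : Equiv.Perm ι, (Fintype.card ι : ℝ≥0∞)⁻¹ * ∑ i, edist (x i) (y (σ i)) ^ p
      ≤ ∫⁻ z, edist z.1 z.2 ^ p ∂(γ : Measure (X × X)) := by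
  have hp' : 0 < p := by linarith
  let μ := (γ : Measure (X × X))
  let m : ι → ℝ := fun i => (Finset.univ.filter fun k => x k = x i).card
  let n : ι → ℝ := fun j => (Finset.univ.filter fun k => y k = y j).card
  have hm : ∀ i, m i ≠ 0 := fun i => by
    simp only [m]
    exact Nat.cast_ne_zero.2 (Finset.card_ne_zero_of_mem (a := i) (by simp))
  have hn : ∀ i, n i ≠ 0 := fun i => by
    simp only [n]
    exact Nat.cast_ne_zero.2 (Finset.card_ne_zero_of_mem (a := i) (by simp))
  have hN : (Fintype.card ι : ℝ) ≠ 0 := by simp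
  let M : Matrix ι ι ℝ := fun i j => Fintype.card ι * (μ.real {(x i, y j)} / n j / m i)
  have hswap : γ.map (f := Prod.swap) measurable_swap.aemeasurable
      ∈ couplings (uniformMeasure y) (uniformMeasure x) := by
    refine ⟨?_, ?_⟩
    · rw [ProbabilityMeasure.toMeasure_map, Measure.map_map measurable_fst measurable_swap]
      exact hγ.2
    · rw [ProbabilityMeasure.toMeasure_map, Measure.map_map measurable_snd measurable_swap]
      exact hγ.1
  have hM : M ∈ doublyStochastic ℝ ι := by
    rw [mem_doublyStochastic_iff_sum]
    refine ⟨fun i j => by positivity, fun i => ?_, fun j => ?_⟩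
    · have := sum_coupling_div_card_fiber hγ i
      simp only [M, ← Finset.mul_sum, ← Finset.sum_div]
      change (Fintype.card ι : ℝ) * ((∑ j, μ.real {(x i, y j)} / n j) / m i) = 1
      rw [show ∑ j, μ.real {(x i, y j)} / n j = m i / Fintype.card ι from this]
      have := hm i
      field_simp
    · have := sum_coupling_div_card_fiber hswap j
      have e : ∀ i, (γ.map (f := Prod.swap) measurable_swap.aemeasurable : Measure (X × X)).real
          {(y j, x i)} = μ.real {(x i, y j)} := fun i => by
        rw [ProbabilityMeasure.toMeasure_map,
          map_measureReal_apply measurable_swap (measurableSet_singleton _)]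
        congr 1
        ext z
        simp [Prod.ext_iff, and_comm]
      simp only [e] at this
      simp only [M, ← Finset.mul_sum]
      simp only [div_right_comm _ (n j)]
      rw [← Finset.sum_div, show ∑ i, μ.real {(x i, y j)} / m i = n j / Fintype.card ι from this]
      have := hn j
      field_simp
  obtain ⟨σ, hσ⟩ := exists_perm_sum_le_of_mem_doublyStochastic hM fun i j => dist (x i) (y j) ^ p
  refine ⟨σ, ?_⟩
  let S : Finset (X × X) := Finset.univ.image x ×ˢ Finset.univ.image y
  have hsum : ∑ i, ∑ j, M i j * dist (x i) (y j) ^ p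
      = Fintype.card ι * ∑ z ∈ S, μ.real {z} * dist z.1 z.2 ^ p := by
    rw [Finset.sum_product, ← sum_div_card_fiber x, Finset.mul_sum]
    refine Finset.sum_congr rfl fun i _ => ?_
    rw [← sum_div_card_fiber y fun b => μ.real {(x i, b)} * dist (x i) b ^ p, Finset.sum_div,
      Finset.mul_sum]
    refine Finset.sum_congr rfl fun j _ => ?_
    simp only [M, n, m]
    ring
  rw [hsum] at hσ
  have hreal : (Fintype.card ι : ℝ)⁻¹ * ∑ i, dist (x i) (y (σ i)) ^ p
      ≤ ∑ z ∈ S, μ.real {z} * dist z.1 z.2 ^ p := by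
    rw [inv_mul_le_iff₀ (by positivity)]
    exact hσ
  calc (Fintype.card ι : ℝ≥0∞)⁻¹ * ∑ i, edist (x i) (y (σ i)) ^ p
      = ENNReal.ofReal ((Fintype.card ι : ℝ)⁻¹ * ∑ i, dist (x i) (y (σ i)) ^ p) := by
        rw [ENNReal.ofReal_mul (by positivity), ENNReal.ofReal_inv_of_pos (by positivity),
          ENNReal.ofReal_natCast, ENNReal.ofReal_sum_of_nonneg fun i _ => by positivity]
        simp [edist_dist, ENNReal.ofReal_rpow_of_nonneg, hp'.le]
    _ ≤ ENNReal.ofReal (∑ z ∈ S, μ.real {z} * dist z.1 z.2 ^ p) := ENNReal.ofReal_le_ofReal hreal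
    _ = ∑ z ∈ S, edist z.1 z.2 ^ p * μ {z} := by
        rw [ENNReal.ofReal_sum_of_nonneg fun i _ => by positivity]
        refine Finset.sum_congr rfl fun z _ => ?_
        rw [ENNReal.ofReal_mul (by positivity), ofReal_measureReal, mul_comm, edist_dist,
          ENNReal.ofReal_rpow_of_nonneg dist_nonneg hp'.le]
    _ = ∫⁻ z in (S : Set (X × X)), edist z.1 z.2 ^ p ∂μ := (lintegral_finset S _).symm
    _ ≤ _ := setLIntegral_le_lintegral _ _

/-- The Wasserstein distance between uniform measures is attained by a permutation. -/
theorem exists_perm_le_wassersteinEDist (hp : 1 ≤ p) (x y : ι → X) :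
    ∃ σ : Equiv.Perm ι, ((Fintype.card ι : ℝ≥0∞)⁻¹ * ∑ i, edist (x i) (y (σ i)) ^ p) ^ (1 / p)
      ≤ wassersteinEDist p (uniformMeasure x) (uniformMeasure y) := by
  obtain ⟨σ, hσ⟩ := Finite.exists_min fun σ : Equiv.Perm ι =>
    ((Fintype.card ι : ℝ≥0∞)⁻¹ * ∑ i, edist (x i) (y (σ i)) ^ p) ^ (1 / p)
  refine ⟨σ, le_wassersteinEDist hp fun γ hγ => ?_⟩
  obtain ⟨τ, hτ⟩ := exists_perm_le_lintegral hp hγ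
  exact (hσ τ).trans (ENNReal.rpow_le_rpow hτ (by positivity))

/-- The uniform measure on a finite family of points, as a point of the Wasserstein space. -/
def uniformWasserstein (hp : 1 ≤ p) (x : ι → X) : WassersteinSpace p X :=
  ⟨uniformMeasure x, by
    have o : ι := Classical.arbitrary ι
    refine ⟨x o, ?_⟩
    rw [lintegral_uniformMeasure (by fun_prop)]
    exact ENNReal.mul_lt_top (by simp [Fintype.card_pos]) (ENNReal.sum_lt_top.2 fun i _ =>
      ENNReal.rpow_lt_top_of_nonneg (by positivity) (edist_ne_top _ _))⟩

end UniformDist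

/-! ### Approximation by uniform measures on `N + 1` points -/

section Approximation

variable {p : ℝ} {X : Type} [MeasurableSpace X] [MeasurableSingletonClass X]

theorem eq_sum_smul_dirac_of_finset {μ : Measure X} {S : Finset X} (h : μ (S : Set X)ᶜ = 0) :
    μ = ∑ a ∈ S, μ {a} • Measure.dirac a := by
  ext s hs
  have : μ s = ∫⁻ a in (S : Set X), s.indicator 1 a ∂μ := by
    rw [lintegral_indicator_one hs, Measure.restrict_apply hs]
    exact (measure_inter_conull h).symm
  rw [this, lintegral_finset, Measure.finsetSum_apply]
  refine Finset.sum_congr rfl fun a _ => ?_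
  rw [Measure.smul_apply, Measure.dirac_apply' _ hs, smul_eq_mul, mul_comm]

/-- A finitely supported measure is approximated by uniform measures on finite families. -/
theorem eventually_exists_uniformMeasure_of_finset {X : Type} [MetricSpace X] [MeasurableSpace X]
    [BorelSpace X] [SecondCountableTopology X]
    (hp : 1 ≤ p) {ν : ProbabilityMeasure X} {S : Finset X} (hS : (ν : Measure X) (S : Set X)ᶜ = 0)
    {ε : ℝ≥0∞} (hε : ε ≠ 0) :
    ∀ᶠ N in atTop, ∃ x : Fin (N + 1) → X, wassersteinEDist p ν (uniformMeasure x) ≤ ε := by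
  have hp' : 0 < p := by linarith
  have o : X := ν.nonempty.some
  let w : X → ℝ≥0∞ := fun a => (ν : Measure X) {a}
  have hν : (ν : Measure X) = ∑ a ∈ S, w a • Measure.dirac a := eq_sum_smul_dirac_of_finset hS
  have hw : ∑ a ∈ S, w a = 1 := by
    have : (ν : Measure X) Set.univ = 1 := measure_univ
    rw [hν] at this
    simpa using this
  have hw' : ∀ a, w a ≠ ∞ := fun a => measure_ne_top _ _
  let C : ℝ≥0∞ := ∑ a ∈ S, edist a o ^ p
  have hC : C ≠ ∞ := (ENNReal.sum_lt_top.2 fun i _ =>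
      ENNReal.rpow_lt_top_of_nonneg (by positivity) (edist_ne_top _ _)).ne
  have hlim : Tendsto (fun N : ℕ => C * ((N + 1 : ℕ) : ℝ≥0∞)⁻¹) atTop (𝓝 0) := by
    have := ENNReal.Tendsto.const_mul (a := C)
      (ENNReal.tendsto_inv_nat_nhds_zero.comp (tendsto_add_atTop_nat 1)) (Or.inr hC)
    simpa using this
  filter_upwards [hlim.eventually_le_const (ENNReal.rpow_pos_of_nonneg
    (pos_iff_ne_zero.2 hε) hp'.le)] with N hN
  set K : ℝ≥0∞ := ((N + 1 : ℕ) : ℝ≥0∞) with hK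
  have hK0 : K ≠ 0 := by simp [hK]
  have hKt : K ≠ ∞ := by simp [hK]
  -- Round each weight down to a multiple `u a` of `1 / (N + 1)` and move the remainder `v a` to
  -- `o`. Each remainder is at most `1 / (N + 1)`, so the cost is at most `C / (N + 1)`.
  let n : X → ℕ := fun a => ⌊(N + 1 : ℕ) * (w a).toReal⌋₊
  let u : X → ℝ≥0∞ := fun a => K⁻¹ * n a
  have hu : ∀ a, u a ≤ w a := fun a => by
    have : (n a : ℝ) ≤ (N + 1 : ℕ) * (w a).toReal := Nat.floor_le (by positivity)
    simp only [u]
    rw [ENNReal.inv_mul_le_iff hK0 hKt, ← ENNReal.ofReal_natCast (n a)]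
    refine (ENNReal.ofReal_le_ofReal this).trans_eq ?_
    rw [ENNReal.ofReal_mul (by positivity), ENNReal.ofReal_natCast, ENNReal.ofReal_toReal (hw' a)]
  let v : X → ℝ≥0∞ := fun a => w a - u a
  have huv : ∀ a, u a + v a = w a := fun a => add_tsub_cancel_of_le (hu a)
  have hv : ∀ a, v a ≤ K⁻¹ := fun a => by
    simp only [v]
    rw [tsub_le_iff_right]
    have : (N + 1 : ℕ) * (w a).toReal ≤ n a + 1 := (Nat.lt_floor_add_one _).le
    have h2 := ENNReal.ofReal_le_ofReal this
    rw [ENNReal.ofReal_mul (by positivity), ENNReal.ofReal_natCast, ENNReal.ofReal_toReal (hw' a),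
      ENNReal.ofReal_add (by positivity) zero_le_one, ENNReal.ofReal_natCast,
      ENNReal.ofReal_one] at h2
    calc w a = K⁻¹ * (K * w a) := by rw [← mul_assoc, ENNReal.inv_mul_cancel hK0 hKt, one_mul]
      _ ≤ K⁻¹ * (n a + 1) := by gcongr
      _ = K⁻¹ + u a := by rw [mul_add, mul_one, add_comm]
  have hu_sum : ∑ a ∈ S, u a = K⁻¹ * (∑ a ∈ S, n a : ℕ) := by
    simp [u, Finset.mul_sum]
  have hn : ∑ a ∈ S, n a ≤ N + 1 := by
    have : ∑ a ∈ S, u a ≤ 1 := hw ▸ Finset.sum_le_sum fun a _ => hu a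
    rw [hu_sum, ENNReal.inv_mul_le_iff hK0 hKt, mul_one] at this
    rw [hK] at this
    exact_mod_cast this
  -- The remainders add up to exactly `k / (N + 1)`, so `k` copies of `o` complete the family.
  obtain ⟨k, hk⟩ := Nat.exists_eq_add_of_le hn
  have hv_sum : ∑ a ∈ S, v a = K⁻¹ * k := by
    have h₁ : ∑ a ∈ S, u a + ∑ a ∈ S, v a = 1 := by
      rw [← Finset.sum_add_distrib, ← hw]
      exact Finset.sum_congr rfl fun a _ => huv a
    have h₂ : ∑ a ∈ S, u a + K⁻¹ * k = 1 := by
      rw [hu_sum, ← mul_add, ← Nat.cast_add, ← hk, ENNReal.inv_mul_cancel hK0 hKt]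
    have h₃ : ∑ a ∈ S, u a ≠ ∞ := ne_top_of_le_ne_top ENNReal.one_ne_top (h₁ ▸ le_self_add)
    exact (ENNReal.add_right_inj h₃).1 (h₁.trans h₂.symm)
  let ι := (Σ a : S, Fin (n a)) ⊕ Fin k
  have hcard : Fintype.card ι = N + 1 := by
    simp only [ι, Fintype.card_sum, Fintype.card_sigma, Fintype.card_fin]
    rw [hk, Finset.sum_coe_sort S n]
  let e : Fin (N + 1) ≃ ι := (Fintype.equivFinOfCardEq hcard).symm
  have : Nonempty ι := ⟨e 0⟩
  let x : ι → X := Sum.elim (fun s => (s.1 : X)) fun _ => o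
  refine ⟨x ∘ e, ?_⟩
  rw [uniformMeasure_comp_equiv]
  have hx : (uniformMeasure x : Measure X)
      = ∑ a ∈ S, u a • Measure.dirac a + (∑ a ∈ S, v a) • Measure.dirac o := by
    rw [toMeasure_uniformMeasure, hcard, Fintype.sum_sum_type, Fintype.sum_sigma, hv_sum]
    simp only [x, Sum.elim_inl, Sum.elim_inr, Finset.sum_const, Finset.card_univ,
      Fintype.card_fin]
    rw [smul_add, Finset.sum_coe_sort S fun a => n a • Measure.dirac a, Finset.smul_sum]
    simp only [u, ← hK, mul_smul, Nat.cast_smul_eq_nsmul]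
  let γ : Measure (X × X) :=
    ∑ a ∈ S, u a • Measure.dirac (a, a) + ∑ a ∈ S, v a • Measure.dirac (a, o)
  have hfst : γ.map Prod.fst = (ν : Measure X) := by
    simp only [γ]
    rw [Measure.map_add _ _ measurable_fst, Measure.map_finset_sum measurable_fst.aemeasurable,
      Measure.map_finset_sum measurable_fst.aemeasurable, ← Finset.sum_add_distrib, hν]
    refine Finset.sum_congr rfl fun a _ => ?_
    rw [Measure.map_smul, Measure.map_smul, Measure.map_dirac' measurable_fst,
      Measure.map_dirac' measurable_fst, ← add_smul, huv]
  have hsnd : γ.map Prod.snd = (uniformMeasure x : Measure X) := by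
    simp only [γ]
    rw [Measure.map_add _ _ measurable_snd, Measure.map_finset_sum measurable_snd.aemeasurable,
      Measure.map_finset_sum measurable_snd.aemeasurable, hx, Finset.sum_smul]
    simp only [Measure.map_smul, Measure.map_dirac' measurable_snd]
  have hγ : IsProbabilityMeasure γ := ⟨by
    have : γ.map Prod.fst Set.univ = 1 := by rw [hfst]; exact measure_univ
    rwa [Measure.map_apply measurable_fst MeasurableSet.univ] at this⟩
  refine (wassersteinEDist_le_of_coupling hp (γ := ⟨γ, hγ⟩) ⟨hfst, hsnd⟩).trans ?_
  change (∫⁻ z, edist z.1 z.2 ^ p ∂γ) ^ (1 / p) ≤ ε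
  rw [one_div, ENNReal.rpow_inv_le_iff hp']
  refine le_trans ?_ hN
  have hm : Measurable fun z : X × X => edist z.1 z.2 ^ p := by fun_prop
  simp only [γ]
  rw [lintegral_add_measure, lintegral_finsetSum_measure, lintegral_finsetSum_measure]
  simp only [lintegral_smul_measure, lintegral_dirac' _ hm, edist_self,
    ENNReal.zero_rpow_of_pos hp', smul_eq_mul, mul_zero,
    Finset.sum_const_zero, zero_add, C, Finset.sum_mul]
  exact Finset.sum_le_sum fun a _ => by rw [mul_comm]; gcongr; exact hv a

variable {E : Type} [NormedAddCommGroup E] [MeasurableSpace E] [BorelSpace E]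
  [SecondCountableTopology E]

theorem memLp_id_of_lintegral_edist (hp : 1 ≤ p) {μ : Measure E} [IsFiniteMeasure μ] {x₀ : E}
    (h : ∫⁻ x, edist x x₀ ^ p ∂μ < ∞) : MemLp id (ENNReal.ofReal p) μ := by
  have hp' : 0 < p := by linarith
  have : MemLp (fun x => x - x₀) (ENNReal.ofReal p) μ := by
    refine ⟨by fun_prop, ?_⟩
    rw [eLpNorm_eq_lintegral_rpow_enorm_toReal (by simpa using hp') ENNReal.ofReal_ne_top,
      ENNReal.toReal_ofReal hp'.le]
    refine ENNReal.rpow_lt_top_of_nonneg (by positivity) ?_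
    simpa [edist_eq_enorm_sub] using h.ne
  have h2 := this.add (memLp_const x₀)
  convert h2 using 1
  ext x
  simp

/-- Every measure with finite `p`-th moment is approximated by uniform measures on families of
`N + 1` points, for all large `N`. -/
theorem eventually_exists_uniformMeasure [StandardBorelSpace E] (hp : 1 ≤ p)
    (α : WassersteinSpace p E) {ε : ℝ≥0∞} (hε : ε ≠ 0) :
    ∀ᶠ N in atTop, ∃ x : Fin (N + 1) → E, wassersteinEDist p α.1 (uniformMeasure x) ≤ ε := by
  have hp' : 0 < p := by linarith
  obtain ⟨x₀, hx₀⟩ := α.2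
  have hε2 : ε / 2 ≠ 0 := by simpa using hε
  -- A simple function close to the identity in `L^p` pushes the measure to a finitely supported one
  -- at small distance.
  obtain ⟨g, hg, -⟩ := (memLp_id_of_lintegral_edist hp hx₀).exists_simpleFunc_eLpNorm_sub_lt
    ENNReal.ofReal_ne_top hε2
  let ν := α.1.map (f := g) g.measurable.aemeasurable
  have hν : (ν : Measure E) (g.range : Set E)ᶜ = 0 := by
    simp only [ν]
    rw [ProbabilityMeasure.toMeasure_map,
      Measure.map_apply g.measurable g.range.measurableSet.compl]
    convert measure_empty (μ := (α.1 : Measure E))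
    ext x
    simp
  have h₁ : wassersteinEDist p α.1 ν ≤ ε / 2 := by
    refine (wassersteinEDist_map_le hp g.measurable).trans (le_trans (le_of_eq ?_) hg.le)
    rw [eLpNorm_eq_lintegral_rpow_enorm_toReal (by simpa using hp') ENNReal.ofReal_ne_top,
      ENNReal.toReal_ofReal hp'.le]
    simp [edist_eq_enorm_sub]
  filter_upwards [eventually_exists_uniformMeasure_of_finset hp hν hε2] with N ⟨x, hx⟩
  exact ⟨x, (wassersteinEDist_triangle hp).trans
    ((add_le_add h₁ hx).trans_eq (ENNReal.add_halves ε))⟩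

end Approximation

/-! ### Removing the normalization by a dilation -/

section ScaledUniform

variable {p : ℝ} {E : Type} [NormedAddCommGroup E] [NormedSpace ℝ E]
  {ι : Type*} [Fintype ι] [Nonempty ι]

theorem scaledUniform_cost (hp : 1 ≤ p) (x y : ι → E) (σ : Equiv.Perm ι) :
    ((Fintype.card ι : ℝ≥0∞)⁻¹ * ∑ i, edist (((Fintype.card ι : ℝ) ^ (1 / p)) • x i)
      (((Fintype.card ι : ℝ) ^ (1 / p)) • y (σ i)) ^ p) ^ (1 / p)
      = (((∑ i, nndist (x i) (y (σ i)) ^ p) ^ (1 / p) : ℝ≥0) : ℝ≥0∞) := by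
  have hp' : 0 < p := by linarith
  have hN : (Fintype.card ι : ℝ≥0) ≠ 0 := by simp
  have hc : ‖(Fintype.card ι : ℝ) ^ (1 / p)‖₊ ^ p = Fintype.card ι := by
    apply NNReal.eq
    rw [NNReal.coe_rpow, coe_nnnorm, Real.norm_of_nonneg (by positivity),
      ← Real.rpow_mul (by positivity), one_div_mul_cancel hp'.ne', Real.rpow_one]
    simp
  rw [ENNReal.coe_rpow_of_nonneg _ (by positivity)]
  congr 1
  have : ∀ i, edist (((Fintype.card ι : ℝ) ^ (1 / p)) • x i)
      (((Fintype.card ι : ℝ) ^ (1 / p)) • y (σ i)) ^ p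
      = (((Fintype.card ι : ℝ≥0) * nndist (x i) (y (σ i)) ^ p : ℝ≥0) : ℝ≥0∞) := fun i => by
    rw [edist_nndist, nndist_smul₀, ← ENNReal.coe_rpow_of_nonneg _ hp'.le, NNReal.mul_rpow, hc]
  simp_rw [this]
  rw [← ENNReal.ofNNReal_finsetSum, ← Finset.mul_sum, ENNReal.coe_mul, ← mul_assoc,
    ENNReal.coe_natCast, ENNReal.inv_mul_cancel (by simp) (by simp), one_mul]

variable [MeasurableSpace E] [BorelSpace E] [SecondCountableTopology E]

/-- The uniform measure on a family of `N` points, rescaled by `N ^ (1 / p)` so that transport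
costs become unnormalized sums. -/
def scaledUniform (hp : 1 ≤ p) (x : ι → E) : WassersteinSpace p E :=
  uniformWasserstein hp fun i => ((Fintype.card ι : ℝ) ^ (1 / p)) • x i

variable [StandardBorelSpace E]

theorem wassersteinDist_scaledUniform_le (hp : 1 ≤ p) (x y : ι → E) (σ : Equiv.Perm ι) :
    WassersteinSpace.wassersteinDist p (scaledUniform hp x) (scaledUniform hp y)
      ≤ (∑ i, nndist (x i) (y (σ i)) ^ p) ^ (1 / p) := by
  rw [← ENNReal.coe_le_coe, coe_wassersteinDist hp, ← scaledUniform_cost hp]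
  exact wassersteinEDist_uniformMeasure_le hp _ _ σ

theorem exists_perm_le_wassersteinDist_scaledUniform (hp : 1 ≤ p) (x y : ι → E) :
    ∃ σ : Equiv.Perm ι, (∑ i, nndist (x i) (y (σ i)) ^ p) ^ (1 / p)
      ≤ WassersteinSpace.wassersteinDist p (scaledUniform hp x) (scaledUniform hp y) := by
  obtain ⟨σ, hσ⟩ := exists_perm_le_wassersteinEDist hp
    (fun i => ((Fintype.card ι : ℝ) ^ (1 / p)) • x i)
    (fun i => ((Fintype.card ι : ℝ) ^ (1 / p)) • y i)
  refine ⟨σ, ?_⟩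
  rw [← ENNReal.coe_le_coe, coe_wassersteinDist hp, ← scaledUniform_cost hp]
  exact hσ

end ScaledUniform

/-! ### Projection to the diagonal in the `ℓ^∞` distance -/

section Diagonal

/-- The nearest-point projection of the plane to the diagonal. -/
def diagProj (x : ℝ × ℝ) : ℝ × ℝ := ((x.1 + x.2) / 2, (x.1 + x.2) / 2)

theorem dist_diagProj (x : ℝ × ℝ) : dist x (diagProj x) = |x.2 - x.1| / 2 := by
  rw [Prod.dist_eq, Real.dist_eq, Real.dist_eq]
  simp only [diagProj]
  rw [show x.1 - (x.1 + x.2) / 2 = -((x.2 - x.1) / 2) by ring,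
    show x.2 - (x.1 + x.2) / 2 = (x.2 - x.1) / 2 by ring, abs_neg, max_self, abs_div]
  norm_num

theorem dist_diagProj_le (x z : ℝ × ℝ) (hz : z ∈ Set.diagonal ℝ) :
    dist x (diagProj x) ≤ dist x z := by
  obtain ⟨a, b⟩ := z
  obtain rfl : a = b := hz
  rw [dist_diagProj]
  have h₁ : |x.1 - a| ≤ dist x (a, a) := le_max_left _ _
  have h₂ : |x.2 - a| ≤ dist x (a, a) := le_max_right _ _
  have := abs_sub_le x.2 a x.1
  rw [abs_sub_comm a] at this
  linarith

theorem diagProj_mem (x : ℝ × ℝ) : diagProj x ∈ Set.diagonal ℝ := rfl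

theorem infNndist_le_nndist_of_mem {X : Type*} [PseudoMetricSpace X] {s : Set X} {x y : X}
    (h : y ∈ s) : Metric.infNndist x s ≤ nndist x y := by
  rw [← NNReal.coe_le_coe, Metric.coe_infNndist, coe_nndist]
  exact Metric.infDist_le_dist_of_mem h

theorem infNndist_diagonal (x : ℝ × ℝ) :
    Metric.infNndist x (Set.diagonal ℝ) = nndist x (diagProj x) := by
  refine le_antisymm (infNndist_le_nndist_of_mem (diagProj_mem x)) ?_
  rw [← NNReal.coe_le_coe, Metric.coe_infNndist, coe_nndist]
  exact (Metric.le_infDist ⟨_, diagProj_mem x⟩).2 fun z hz => dist_diagProj_le x z hz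

/-- Averaging the coordinates is `1`-Lipschitz. This pays for the pairs of projected points in
`exists_perm_spread_le`. -/
theorem nndist_diagProj_diagProj_le (x y : ℝ × ℝ) :
    nndist (diagProj x) (diagProj y) ≤ nndist x y := by
  rw [← NNReal.coe_le_coe, coe_nndist, coe_nndist]
  have h₁ : |x.1 - y.1| ≤ dist x y := le_max_left _ _
  have h₂ : |x.2 - y.2| ≤ dist x y := le_max_right _ _
  rw [Prod.dist_eq, Real.dist_eq]
  simp only [diagProj, Real.dist_eq, max_self]
  rw [show (x.1 + x.2) / 2 - (y.1 + y.2) / 2 = ((x.1 - y.1) + (x.2 - y.2)) / 2 by ring, abs_div,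
    abs_two]
  have := abs_add_le (x.1 - y.1) (x.2 - y.2)
  linarith

end Diagonal

/-! ### Partial matchings from pairs of injections -/

/-- A finite type is equivalent to its image under an injection, as a finset. -/
def equivMapUniv {K A : Type*} [Fintype K] (u : K ↪ A) : K ≃ (Finset.univ.map u : Finset A) :=
  Equiv.ofBijective (fun k => ⟨u k, Finset.mem_map_of_mem u (Finset.mem_univ k)⟩)
    ⟨fun _ _ h => u.injective (congrArg Subtype.val h), fun ⟨a, ha⟩ => by
      obtain ⟨k, -, rfl⟩ := Finset.mem_map.1 ha
      exact ⟨k, rfl⟩⟩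

namespace PartialMatching

open PersistenceDiagram

variable {D₁ D₂ : PersistenceDiagram} {p : ℝ}

instance : Nonempty (PartialMatching D₁ D₂) :=
  ⟨⟨∅, ∅, Equiv.equivOfIsEmpty _ _⟩⟩

open Classical in
theorem cost_eq (m : PartialMatching D₁ D₂) :
    m.cost p = (∑ x : m.B₁, nndist (point x.1) (point (m.f x).1) ^ p
      + ∑ x : {x // x ∉ m.B₁}, Metric.infNndist (point x.1) (Set.diagonal ℝ) ^ p
      + ∑ y : {y // y ∉ m.B₂}, Metric.infNndist (point y.1) (Set.diagonal ℝ) ^ p) ^ (1 / p) := by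
  rw [cost, Finset.sum_subtype m.B₁ᶜ (p := (· ∉ m.B₁)) (by simp),
    Finset.sum_subtype m.B₂ᶜ (p := (· ∉ m.B₂)) (by simp)]

/-- The partial matching given by two injections from a common index set. -/
def ofInjective {K : Type*} [Fintype K] (u : K → D₁.ToType) (v : K → D₂.ToType)
    (hu : u.Injective) (hv : v.Injective) : PartialMatching D₁ D₂ where
  B₁ := Finset.univ.map ⟨u, hu⟩
  B₂ := Finset.univ.map ⟨v, hv⟩
  f := (equivMapUniv ⟨u, hu⟩).symm.trans (equivMapUniv ⟨v, hv⟩)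

open Classical in
theorem cost_ofInjective {K : Type*} [Fintype K] (u : K → D₁.ToType) (v : K → D₂.ToType)
    (hu : u.Injective) (hv : v.Injective) :
    (ofInjective u v hu hv).cost p = (∑ k, nndist (point (u k)) (point (v k)) ^ p
      + ∑ x : {x // x ∉ Set.range u}, Metric.infNndist (point x.1) (Set.diagonal ℝ) ^ p
      + ∑ y : {y // y ∉ Set.range v}, Metric.infNndist (point y.1) (Set.diagonal ℝ) ^ p)
        ^ (1 / p) := by
  have h₁ : ∀ x, x ∉ (ofInjective u v hu hv).B₁ ↔ x ∉ Set.range u := by simp [ofInjective]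
  have h₂ : ∀ x, x ∉ (ofInjective u v hu hv).B₂ ↔ x ∉ Set.range v := by simp [ofInjective]
  rw [cost_eq]
  congr 1
  refine congrArg₂ _ (congrArg₂ _ ?_ ?_) ?_
  · symm
    refine Fintype.sum_equiv (equivMapUniv ⟨u, hu⟩) _ _ fun k => ?_
    have : (ofInjective u v hu hv).f (equivMapUniv ⟨u, hu⟩ k) = equivMapUniv ⟨v, hv⟩ k :=
      congrArg (equivMapUniv ⟨v, hv⟩) (Equiv.symm_apply_apply _ k)
    rw [this]
    rfl
  · exact Fintype.sum_equiv (Equiv.subtypeEquivRight h₁) _ _ fun _ => rfl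
  · exact Fintype.sum_equiv (Equiv.subtypeEquivRight h₂) _ _ fun _ => rfl

end PartialMatching

theorem Fintype.sum_comp_le_of_injective {α β : Type*} [Fintype α] [Fintype β] {e : α → β}
    (he : e.Injective) (g : β → ℝ≥0) : ∑ a, g (e a) ≤ ∑ b, g b := by
  exact (Finset.sum_map Finset.univ ⟨e, he⟩ g).symm.trans_le
    (Finset.sum_le_sum_of_subset (Finset.subset_univ _))

/-! ### From diagrams to families with a common index set -/

section Spread

open PersistenceDiagram

variable {p : ℝ} {F : Finset PersistenceDiagram} {D₁ D₂ : PersistenceDiagram}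

/-- The points of all the diagrams of `F`, the points outside of `D` being projected to the
diagonal. This enlarges the diagrams of `F` to families of points with a common index set. -/
def spread (F : Finset PersistenceDiagram) (D : PersistenceDiagram)
    (s : Σ D' : F, D'.1.ToType) : ℝ × ℝ :=
  if s.1.1 = D then point s.2 else diagProj (point s.2)

theorem spread_self (h : D₁ ∈ F) (a : D₁.ToType) : spread F D₁ ⟨⟨D₁, h⟩, a⟩ = point a := by
  simp [spread]

theorem spread_of_ne {s : Σ D' : F, D'.1.ToType} (h : s.1.1 ≠ D₁) :
    spread F D₁ s = diagProj (point s.2) := by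
  simp [spread, h]

-- Keep the pairs that `σ` forms between a point of `D₁` and a point of `D₂`. Every other point of
-- either diagram is paired with a point of the diagonal, so its term is at least its distance to
-- the diagonal.
open Classical in
theorem wassersteinDist_le_spread (hp : 1 ≤ p) (h₁ : D₁ ∈ F) (h₂ : D₂ ∈ F)
    (σ : Equiv.Perm (Σ D' : F, D'.1.ToType)) :
    wassersteinDist p D₁ D₂ ≤ (∑ i, nndist (spread F D₁ i) (spread F D₂ (σ i)) ^ p) ^ (1 / p) := by
  let i₁ : D₁.ToType → Σ D' : F, D'.1.ToType := fun a => ⟨⟨D₁, h₁⟩, a⟩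
  let i₂ : D₂.ToType → Σ D' : F, D'.1.ToType := fun b => ⟨⟨D₂, h₂⟩, b⟩
  have hi₁ : i₁.Injective := fun a b h => eq_of_heq (Sigma.mk.inj h).2
  have hi₂ : i₂.Injective := fun a b h => eq_of_heq (Sigma.mk.inj h).2
  let K := {a : D₁.ToType // ∃ b, σ (i₁ a) = i₂ b}
  let _ : Fintype K := Subtype.fintype _
  let u : K → D₁.ToType := Subtype.val
  choose v hv using fun k : K => k.2
  have hu : u.Injective := Subtype.val_injective
  have hv' : v.Injective := fun k l h => Subtype.ext
    (hi₁ (σ.injective ((hv k).trans ((congrArg i₂ h).trans (hv l).symm))))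
  let c : (Σ D' : F, D'.1.ToType) → ℝ≥0 :=
    fun i => nndist (spread F D₁ i) (spread F D₂ (σ i)) ^ p
  -- `e` sends each term of the matching cost to a distinct index dominating it; the remaining
  -- indices only add nonnegative terms.
  let e : (K ⊕ {x // x ∉ Set.range u}) ⊕ {y // y ∉ Set.range v} → Σ D' : F, D'.1.ToType :=
    Sum.elim (Sum.elim (i₁ ∘ u) (fun a => i₁ a.1)) (fun b => σ.symm (i₂ b.1))
  have he : e.Injective := by
    refine Function.Injective.sumElim (Function.Injective.sumElim (hi₁.comp hu)
      (hi₁.comp Subtype.val_injective) fun k a h => ?_)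
      (σ.symm.injective.comp (hi₂.comp Subtype.val_injective)) ?_
    · exact a.2 ⟨k, hi₁ h⟩
    · have aux : ∀ (a : D₁.ToType) (b : {y // y ∉ Set.range v}), i₁ a ≠ σ.symm (i₂ b.1) := by
        intro a b h
        have h' : σ (i₁ a) = i₂ b.1 := by rw [h, Equiv.apply_symm_apply]
        exact b.2 ⟨⟨a, b.1, h'⟩, hi₂ ((hv ⟨a, b.1, h'⟩).symm.trans h')⟩
      rintro (k | a) b
      exacts [aux _ b, aux _ b]
  refine (ciInf_le' _ (PartialMatching.ofInjective u v hu hv')).trans ?_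
  rw [PartialMatching.cost_ofInjective]
  refine NNReal.rpow_le_rpow ?_ (by positivity)
  refine le_trans ?_ (Fintype.sum_comp_le_of_injective he c)
  rw [Fintype.sum_sum_type, Fintype.sum_sum_type]
  refine add_le_add (add_le_add (Finset.sum_le_sum fun k _ => ?_)
    (Finset.sum_le_sum fun a _ => ?_)) (Finset.sum_le_sum fun b _ => ?_)
  · simp only [c, e, Sum.elim_inl, Function.comp_apply]
    rw [hv k, spread_self h₁, spread_self h₂]
  · simp only [c, e, Sum.elim_inl, Sum.elim_inr]
    rw [spread_self h₁]
    refine NNReal.rpow_le_rpow (infNndist_le_nndist_of_mem ?_) (by positivity)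
    rw [spread_of_ne]
    · exact diagProj_mem _
    · intro h
      refine a.2 ⟨⟨a.1, ?_⟩, rfl⟩
      rcases h' : σ (i₁ a.1) with ⟨⟨D, hD⟩, b⟩
      rw [h'] at h
      obtain rfl : D = D₂ := h
      exact ⟨b, rfl⟩
  · simp only [c, e, Sum.elim_inr]
    rw [Equiv.apply_symm_apply, spread_self h₂, nndist_comm]
    refine NNReal.rpow_le_rpow (infNndist_le_nndist_of_mem ?_) (by positivity)
    rw [spread_of_ne]
    · exact diagProj_mem _
    · intro h
      rcases h' : σ.symm (i₂ b.1) with ⟨⟨D, hD⟩, a⟩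
      rw [h'] at h
      obtain rfl : D = D₁ := h
      have h'' : σ (i₁ a) = i₂ b.1 := by rw [← Equiv.eq_symm_apply, h']
      exact b.2 ⟨⟨a, b.1, h''⟩, hi₂ ((hv ⟨a, b.1, h''⟩).symm.trans h'')⟩

-- Let `σ` exchange the indices of matched points and fix all others. An exchange costs one matched
-- distance and one distance between projections, which is no larger; a fixed unmatched point pays
-- its distance to the diagonal, and all other indices pay nothing. The exchange needs the two index
-- blocks disjoint, hence `D₁ ≠ D₂`.
open Classical in
theorem exists_perm_spread_le (hp : 1 ≤ p) (h₁ : D₁ ∈ F) (h₂ : D₂ ∈ F) (hne : D₁ ≠ D₂)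
    (m : PartialMatching D₁ D₂) : ∃ σ : Equiv.Perm (Σ D' : F, D'.1.ToType),
      (∑ i, nndist (spread F D₁ i) (spread F D₂ (σ i)) ^ p) ^ (1 / p) ≤ 2 * m.cost p := by
  have hp' : 0 < p := by linarith
  let i₁ : D₁.ToType → Σ D' : F, D'.1.ToType := fun a => ⟨⟨D₁, h₁⟩, a⟩
  let i₂ : D₂.ToType → Σ D' : F, D'.1.ToType := fun b => ⟨⟨D₂, h₂⟩, b⟩
  have hi₁ : i₁.Injective := fun a b h => eq_of_heq (Sigma.mk.inj h).2
  have hi₂ : i₂.Injective := fun a b h => eq_of_heq (Sigma.mk.inj h).2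
  have hi : ∀ a b, i₁ a ≠ i₂ b := fun a b h => hne (congrArg (fun s => s.1.1) h)
  let u : m.B₁ → D₁.ToType := Subtype.val
  let v : m.B₁ → D₂.ToType := fun k => (m.f k).1
  have hu : u.Injective := Subtype.val_injective
  have hv : v.Injective := Subtype.val_injective.comp m.f.injective
  let w : m.B₁ ⊕ m.B₁ ↪ Σ D' : F, D'.1.ToType := ⟨Sum.elim (i₁ ∘ u) (i₂ ∘ v),
    Function.Injective.sumElim (hi₁.comp hu) (hi₂.comp hv) fun _ _ => hi _ _⟩
  let σ : Equiv.Perm (Σ D' : F, D'.1.ToType) :=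
    Equiv.Perm.viaEmbedding (Equiv.sumComm m.B₁ m.B₁) w
  have σ₁ : ∀ k, σ (i₁ (u k)) = i₂ (v k) := fun k =>
    Equiv.Perm.viaEmbedding_apply (Equiv.sumComm m.B₁ m.B₁) w (Sum.inl k)
  have σ₂ : ∀ k, σ (i₂ (v k)) = i₁ (u k) := fun k =>
    Equiv.Perm.viaEmbedding_apply (Equiv.sumComm m.B₁ m.B₁) w (Sum.inr k)
  have σ₃ : ∀ i, i ∉ Set.range w → σ i = i := fun i hi =>
    Equiv.Perm.viaEmbedding_apply_of_notMem (Equiv.sumComm m.B₁ m.B₁) w i hi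
  have hva : ∀ b ∈ m.B₂, ∃ k, v k = b := fun b hb => ⟨m.f.symm ⟨b, hb⟩, by simp [v]⟩
  have σ₄ : ∀ a ∉ m.B₁, σ (i₁ a) = i₁ a := fun a ha => σ₃ _ (by
    rintro ⟨k | k, hk⟩
    · exact ha (hi₁ hk ▸ k.2)
    · exact hi _ _ hk.symm)
  have σ₅ : ∀ b ∉ m.B₂, σ (i₂ b) = i₂ b := fun b hb => σ₃ _ (by
    rintro ⟨k | k, hk⟩
    · exact hi _ _ hk
    · exact hb (hi₂ hk ▸ (m.f k).2))
  let c : (Σ D' : F, D'.1.ToType) → ℝ≥0 :=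
    fun i => nndist (spread F D₁ i) (spread F D₂ (σ i)) ^ p
  let e : ((m.B₁ ⊕ {x // x ∉ m.B₁}) ⊕ {y // y ∉ m.B₂}) ⊕ m.B₁ → Σ D' : F, D'.1.ToType :=
    Sum.elim (Sum.elim (Sum.elim (i₁ ∘ u) (fun a => i₁ a.1)) (fun b => i₂ b.1)) (i₂ ∘ v)
  have he : e.Injective := by
    refine Function.Injective.sumElim (Function.Injective.sumElim (Function.Injective.sumElim
      (hi₁.comp hu) (hi₁.comp Subtype.val_injective) ?_) (hi₂.comp Subtype.val_injective) ?_)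
      (hi₂.comp hv) ?_
    · exact fun k a h => a.2 (hi₁ h ▸ k.2)
    · rintro (k | a) b
      exacts [hi _ _, hi _ _]
    · rintro ((k | a) | b) l
      exacts [hi _ _, hi _ _, fun h => b.2 (hi₂ h ▸ (m.f l).2)]
  -- Outside the blocks of `D₁` and `D₂`, both families carry the same projected point and `σ` is
  -- the identity.
  have hsum : ∑ s, c (e s) = ∑ i, c i := by
    refine Fintype.sum_of_injective e he _ _ (fun i hi' => ?_) fun _ => rfl
    obtain ⟨⟨D, hD⟩, a⟩ := i
    have hD₁ : D ≠ D₁ := by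
      rintro rfl
      by_cases ha : a ∈ m.B₁
      · exact hi' ⟨.inl (.inl (.inl ⟨a, ha⟩)), rfl⟩
      · exact hi' ⟨.inl (.inl (.inr ⟨a, ha⟩)), rfl⟩
    have hD₂ : D ≠ D₂ := by
      rintro rfl
      by_cases ha : a ∈ m.B₂
      · obtain ⟨k, rfl⟩ := hva a ha
        exact hi' ⟨.inr k, rfl⟩
      · exact hi' ⟨.inl (.inr ⟨a, ha⟩), rfl⟩
    simp only [c]
    rw [σ₃, spread_of_ne hD₁, spread_of_ne hD₂, nndist_self, NNReal.zero_rpow hp'.ne']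
    rintro ⟨k | k, hk⟩
    · exact hD₁ (congrArg (fun s => s.1.1) hk).symm
    · exact hD₂ (congrArg (fun s => s.1.1) hk).symm
  refine ⟨σ, ?_⟩
  change (∑ i, c i) ^ (1 / p) ≤ _
  rw [← hsum, Fintype.sum_sum_type, Fintype.sum_sum_type, Fintype.sum_sum_type,
    PartialMatching.cost_eq]
  set A := ∑ x : m.B₁, nndist (point x.1) (point (m.f x).1) ^ p
  set B := ∑ x : {x // x ∉ m.B₁}, Metric.infNndist (point x.1) (Set.diagonal ℝ) ^ p
  set C := ∑ y : {y // y ∉ m.B₂}, Metric.infNndist (point y.1) (Set.diagonal ℝ) ^ p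
  have hA : ∑ k, c (e (.inl (.inl (.inl k)))) = A := by
    refine Finset.sum_congr rfl fun k _ => ?_
    simp only [c, e, Sum.elim_inl, Function.comp_apply]
    rw [σ₁, spread_self h₁, spread_self h₂]
  have hB : ∑ k, c (e (.inl (.inl (.inr k)))) = B := by
    refine Finset.sum_congr rfl fun a _ => ?_
    simp only [c, e, Sum.elim_inl, Sum.elim_inr]
    rw [σ₄ _ a.2, spread_self h₁, spread_of_ne (D₁ := D₂) hne, infNndist_diagonal]
  have hC : ∑ k, c (e (.inl (.inr k))) = C := by
    refine Finset.sum_congr rfl fun b _ => ?_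
    simp only [c, e, Sum.elim_inl, Sum.elim_inr]
    rw [σ₅ _ b.2, spread_self h₂, spread_of_ne (D₁ := D₁) hne.symm, infNndist_diagonal,
      nndist_comm]
  have hA' : ∑ k, c (e (.inr k)) ≤ A := by
    refine Finset.sum_le_sum fun k _ => ?_
    simp only [c, e, Sum.elim_inr, Function.comp_apply]
    rw [σ₂, spread_of_ne (D₁ := D₁) hne.symm, spread_of_ne (D₁ := D₂) hne]
    refine NNReal.rpow_le_rpow ((nndist_diagProj_diagProj_le _ _).trans_eq ?_) hp'.le
    rw [nndist_comm]
  rw [hA, hB, hC]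
  calc (A + B + C + ∑ k, c (e (.inr k))) ^ (1 / p)
      ≤ (2 * (A + B + C)) ^ (1 / p) := by
        refine NNReal.rpow_le_rpow ?_ (by positivity)
        rw [two_mul]
        refine add_le_add le_rfl (hA'.trans ?_)
        rw [add_assoc]
        exact le_self_add
    _ = 2 ^ (1 / p) * (A + B + C) ^ (1 / p) := NNReal.mul_rpow
    _ ≤ 2 * (A + B + C) ^ (1 / p) := by
        gcongr
        refine (NNReal.rpow_le_rpow_of_exponent_le one_le_two ?_).trans_eq (NNReal.rpow_one 2)
        rwa [div_le_one hp']

end Spread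

/-! ### From families of points to diagrams far above the diagonal -/

section DiagramOfFamily

open PersistenceDiagram

variable {p : ℝ} {ι : Type*} [Fintype ι]

/-- The points of the multiset enumerated by a finite family are in bijection with its indices. -/
theorem Multiset.exists_equiv_toType_map_univ {A : Type*} [DecidableEq A] (z : ι → A) :
    ∃ e : ι ≃ ((Finset.univ : Finset ι).val.map z).ToType, ∀ i, (e i).1 = z i := by
  classical
  have hs : Function.Surjective fun a : (Finset.univ : Finset ι).val.ToType => a.1 := fun i =>
    ⟨⟨i, ⟨0, Multiset.count_pos.2 (Finset.mem_univ i)⟩⟩, rfl⟩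
  have hb : Function.Bijective fun a : (Finset.univ : Finset ι).val.ToType => a.1 :=
    (Fintype.bijective_iff_surjective_and_card _).2 ⟨hs, by simp⟩
  refine ⟨(Equiv.ofBijective _ hb).symm.trans (Multiset.mapEquiv _ z), fun i => ?_⟩
  obtain ⟨a, rfl⟩ := hs i
  have : (Equiv.ofBijective _ hb).symm a.1 = a := (Equiv.ofBijective _ hb).symm_apply_apply a
  rw [Equiv.trans_apply, this]
  exact Multiset.mapEquiv_apply _ z a

theorem wassersteinDist_le_of_equiv {D₁ D₂ : PersistenceDiagram}
    (e₁ : ι ≃ D₁.ToType) (e₂ : ι ≃ D₂.ToType) (σ : Equiv.Perm ι) :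
    wassersteinDist p D₁ D₂
      ≤ (∑ i, nndist (point (e₁ i)) (point (e₂ (σ i))) ^ p) ^ (1 / p) := by
  classical
  refine (ciInf_le' _ (PartialMatching.ofInjective e₁ (e₂ ∘ σ) e₁.injective
    (e₂.injective.comp σ.injective))).trans_eq ?_
  rw [PartialMatching.cost_ofInjective]
  have h₁ : IsEmpty {x // x ∉ Set.range e₁} := ⟨fun x => x.2 (e₁.surjective x.1)⟩
  have h₂ : IsEmpty {x // x ∉ Set.range (e₂ ∘ σ)} :=
    ⟨fun x => x.2 ((e₂.surjective.comp σ.surjective) x.1)⟩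
  simp

/-- Equal cardinalities allow the partial bijection to be extended to a permutation. By `h`, each
newly paired point of `D₁` costs at most its former distance to the diagonal; the unmatched terms of
`D₂` are dropped. -/
theorem exists_perm_le_cost (hp : 1 ≤ p) {D₁ D₂ : PersistenceDiagram}
    (e₁ : ι ≃ D₁.ToType) (e₂ : ι ≃ D₂.ToType)
    (h : ∀ i j, nndist (point (e₁ i)) (point (e₂ j))
      ≤ Metric.infNndist (point (e₁ i)) (Set.diagonal ℝ)) (m : PartialMatching D₁ D₂) :
    ∃ σ : Equiv.Perm ι, (∑ i, nndist (point (e₁ i)) (point (e₂ (σ i))) ^ p) ^ (1 / p)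
      ≤ m.cost p := by
  classical
  let u : m.B₁ → ι := fun k => e₁.symm k.1
  let v : m.B₁ → ι := fun k => e₂.symm (m.f k).1
  have hu : u.Injective := e₁.symm.injective.comp Subtype.val_injective
  have hv : v.Injective := e₂.symm.injective.comp (Subtype.val_injective.comp m.f.injective)
  let g : {i // i ∈ Set.range u} ≃ {i // i ∈ Set.range v} :=
    (Equiv.ofInjective u hu).symm.trans (Equiv.ofInjective v hv)
  let σ : Equiv.Perm ι := g.extendSubtype
  have hσ : ∀ k, σ (u k) = v k := fun k => by
    have h₁ : σ (u k) = g ⟨u k, ⟨k, rfl⟩⟩ := g.extendSubtype_apply_of_mem _ ⟨k, rfl⟩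
    rw [h₁]
    have h₂ : (Equiv.ofInjective u hu).symm ⟨u k, ⟨k, rfl⟩⟩ = k :=
      (Equiv.ofInjective u hu).symm_apply_apply k
    simp only [g, Equiv.trans_apply, h₂]
    rfl
  refine ⟨σ, ?_⟩
  rw [PartialMatching.cost_eq]
  refine NNReal.rpow_le_rpow (le_trans ?_ le_self_add) (by positivity)
  have hsum : ∑ i, nndist (point (e₁ i)) (point (e₂ (σ i))) ^ p
      = ∑ a, nndist (point a) (point (e₂ (σ (e₁.symm a)))) ^ p :=
    Fintype.sum_equiv e₁ _ _ fun i => by rw [Equiv.symm_apply_apply]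
  rw [hsum, ← Finset.sum_add_sum_compl m.B₁, ← Finset.sum_coe_sort,
    Finset.sum_subtype m.B₁ᶜ (p := (· ∉ m.B₁)) (by simp)]
  refine add_le_add (Finset.sum_le_sum fun k _ => ?_) (Finset.sum_le_sum fun a _ => ?_)
  · have : σ (e₁.symm k.1) = e₂.symm (m.f k).1 := hσ k
    rw [this, Equiv.apply_symm_apply]
  · refine NNReal.rpow_le_rpow ?_ (by positivity)
    have := h (e₁.symm a.1) (σ (e₁.symm a.1))
    rwa [Equiv.apply_symm_apply] at this

theorem exists_perm_le_wassersteinDist (hp : 1 ≤ p) {D₁ D₂ : PersistenceDiagram}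
    (e₁ : ι ≃ D₁.ToType) (e₂ : ι ≃ D₂.ToType)
    (h : ∀ i j, nndist (point (e₁ i)) (point (e₂ j))
      ≤ Metric.infNndist (point (e₁ i)) (Set.diagonal ℝ)) :
    ∃ σ : Equiv.Perm ι, (∑ i, nndist (point (e₁ i)) (point (e₂ (σ i))) ^ p) ^ (1 / p)
      ≤ wassersteinDist p D₁ D₂ := by
  obtain ⟨σ, hσ⟩ := Finite.exists_min fun σ : Equiv.Perm ι =>
    (∑ i, nndist (point (e₁ i)) (point (e₂ (σ i))) ^ p) ^ (1 / p)
  refine ⟨σ, le_ciInf fun m => ?_⟩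
  obtain ⟨τ, hτ⟩ := exists_perm_le_cost hp e₁ e₂ h m
  exact (hσ τ).trans hτ

/-- The point `x` moved up by `L`, or further if that does not put it above the diagonal. -/
def liftPoint (L : ℝ) (x : ℝ × ℝ) : {x : ℝ × ℝ // x.1 < x.2} :=
  ⟨(x.1, max (x.2 + L) (x.1 + 1)), lt_max_of_lt_right (by simp)⟩

/-- The diagram of the points of a finite family, lifted far above the diagonal. -/
def liftedDiagram (L : ℝ) (x : ι → ℝ × ℝ) : PersistenceDiagram :=
  Finset.univ.val.map fun i => liftPoint L (x i)

theorem coe_liftPoint {R : ℝ} {x : ℝ × ℝ} (hx : ‖x‖ ≤ R) :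
    (liftPoint (6 * R + 1) x : ℝ × ℝ) = x + (0, 6 * R + 1) := by
  have h₁ : |x.1| ≤ R := (norm_fst_le x).trans hx
  have h₂ : |x.2| ≤ R := (norm_snd_le x).trans hx
  rw [abs_le] at h₁ h₂
  ext
  · simp [liftPoint]
  · simp only [liftPoint, Prod.snd_add]
    exact max_eq_left (by linarith)

theorem nndist_liftPoint {R : ℝ} {x y : ℝ × ℝ} (hx : ‖x‖ ≤ R) (hy : ‖y‖ ≤ R) :
    nndist (liftPoint (6 * R + 1) x : ℝ × ℝ) (liftPoint (6 * R + 1) y : ℝ × ℝ) = nndist x y := by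
  rw [coe_liftPoint hx, coe_liftPoint hy, nndist_add_right]

/-- The height `6 * R + 1` is chosen here: the lifted point is at least `(6 * R + 1 - 2 * R) / 2`
from the diagonal, which exceeds the bound `2 * R` on `dist x y`. -/
theorem nndist_le_infNndist_liftPoint {R : ℝ} {x y : ℝ × ℝ} (hx : ‖x‖ ≤ R) (hy : ‖y‖ ≤ R) :
    nndist x y ≤ Metric.infNndist (liftPoint (6 * R + 1) x : ℝ × ℝ) (Set.diagonal ℝ) := by
  rw [infNndist_diagonal, coe_liftPoint hx, ← NNReal.coe_le_coe, coe_nndist, coe_nndist,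
    dist_diagProj]
  have h₁ : |x.1| ≤ R := (norm_fst_le x).trans hx
  have h₂ : |x.2| ≤ R := (norm_snd_le x).trans hx
  rw [abs_le] at h₁ h₂
  have h₃ : dist x y ≤ 2 * R := (dist_le_norm_add_norm x y).trans (by linarith)
  simp only [Prod.fst_add, Prod.snd_add, add_zero]
  have := le_abs_self (x.2 + (6 * R + 1) - x.1)
  linarith

/-- Diagrams lifted far above the diagonal are at the distance of the uniform measures. -/
theorem wassersteinDist_liftedDiagram [Nonempty ι] (hp : 1 ≤ p) {R : ℝ} {x y : ι → ℝ × ℝ}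
    (hx : ∀ i, ‖x i‖ ≤ R) (hy : ∀ i, ‖y i‖ ≤ R) :
    wassersteinDist p (liftedDiagram (6 * R + 1) x) (liftedDiagram (6 * R + 1) y)
      = WassersteinSpace.wassersteinDist p (scaledUniform hp x) (scaledUniform hp y) := by
  classical
  have key : ∀ z : ι → ℝ × ℝ, ∃ e : ι ≃ (liftedDiagram (6 * R + 1) z).ToType,
      ∀ i, point (e i) = liftPoint (6 * R + 1) (z i) := fun z => by
    obtain ⟨e, he⟩ := Multiset.exists_equiv_toType_map_univ fun i => liftPoint (6 * R + 1) (z i)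
    exact ⟨e, fun i => congrArg Subtype.val (he i)⟩
  obtain ⟨e₁, h₁⟩ := key x
  obtain ⟨e₂, h₂⟩ := key y
  have hd : ∀ i j, nndist (point (e₁ i)) (point (e₂ j)) = nndist (x i) (y j) := fun i j => by
    rw [h₁, h₂, nndist_liftPoint (hx i) (hy j)]
  refine le_antisymm ?_ ?_
  · obtain ⟨σ, hσ⟩ := exists_perm_le_wassersteinDist_scaledUniform hp x y
    refine (wassersteinDist_le_of_equiv e₁ e₂ σ).trans ?_
    simpa only [hd] using hσ
  · obtain ⟨σ, hσ⟩ := exists_perm_le_wassersteinDist hp e₁ e₂ fun i j => by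
      rw [hd, h₁]
      exact nndist_le_infNndist_liftPoint (hx i) (hy j)
    refine (wassersteinDist_scaledUniform_le hp x y σ).trans ?_
    simpa only [hd] using hσ

end DiagramOfFamily

/-! ### Comparison of finite subsets and the equivalence -/

/-- Finite sets of diagrams map to the Wasserstein space with distortion at most `2`. -/
theorem exists_map_persistenceDiagram_wassersteinSpace {p : ℝ} (hp : 1 ≤ p)
    (F : Finset PersistenceDiagram) :
    ∃ φ : PersistenceDiagram → WassersteinSpace p (ℝ × ℝ), ∀ D₁ ∈ F, ∀ D₂ ∈ F,
      PersistenceDiagram.wassersteinDist p D₁ D₂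
        ≤ WassersteinSpace.wassersteinDist p (φ D₁) (φ D₂) ∧
      WassersteinSpace.wassersteinDist p (φ D₁) (φ D₂)
        ≤ 2 * PersistenceDiagram.wassersteinDist p D₁ D₂ := by
  classical
  -- Adjoining a one-point diagram makes the index set nonempty, as uniform measures require.
  let P : PersistenceDiagram := {⟨(0, 1), one_pos⟩}
  let F' := insert P F
  have : Nonempty P.ToType := Fintype.card_pos_iff.1 (by simp [P])
  have : Nonempty (Σ D : F', D.1.ToType) :=
    ⟨⟨⟨P, Finset.mem_insert_self _ _⟩, Classical.arbitrary _⟩⟩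
  refine ⟨fun D => scaledUniform hp (spread F' D), fun D₁ h₁ D₂ h₂ => ?_⟩
  have h₁' : D₁ ∈ F' := Finset.mem_insert_of_mem h₁
  have h₂' : D₂ ∈ F' := Finset.mem_insert_of_mem h₂
  refine ⟨?_, ?_⟩
  · obtain ⟨σ, hσ⟩ := exists_perm_le_wassersteinDist_scaledUniform hp (spread F' D₁) (spread F' D₂)
    exact (wassersteinDist_le_spread hp h₁' h₂' σ).trans hσ
  · rw [← div_le_iff₀' two_pos]
    refine le_ciInf fun m => ?_
    rw [div_le_iff₀' two_pos]
    by_cases hne : D₁ = D₂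
    · subst hne
      refine le_of_eq_of_le ?_ zero_le
      rw [← ENNReal.coe_inj, coe_wassersteinDist hp, wassersteinEDist_self hp, ENNReal.coe_zero]
    · obtain ⟨σ, hσ⟩ := exists_perm_spread_le hp h₁' h₂' hne m
      exact (wassersteinDist_scaledUniform_le hp _ _ σ).trans hσ

/-- Finite sets of measures map to the space of diagrams with additive distortion at most `2`. -/
theorem exists_map_wassersteinSpace_persistenceDiagram {p : ℝ} (hp : 1 ≤ p)
    (F : Finset (WassersteinSpace p (ℝ × ℝ))) :
    ∃ φ : WassersteinSpace p (ℝ × ℝ) → PersistenceDiagram, ∀ α ∈ F, ∀ β ∈ F,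
      WassersteinSpace.wassersteinDist p α β
        ≤ PersistenceDiagram.wassersteinDist p (φ α) (φ β) + 2 ∧
      PersistenceDiagram.wassersteinDist p (φ α) (φ β)
        ≤ WassersteinSpace.wassersteinDist p α β + 2 := by
  have hp' : 0 < p := by linarith
  -- Approximability for all large `N`, not just some `N`, gives one `N` common to all measures of
  -- `F`.
  have happ : ∀ᶠ N in atTop, ∀ α ∈ F, ∃ x : Fin (N + 1) → ℝ × ℝ,
      wassersteinEDist p α.1 (uniformMeasure x) ≤ 1 :=
    (Filter.eventually_all_finset F).2 fun α _ =>
      eventually_exists_uniformMeasure hp α one_ne_zero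
  obtain ⟨N, hN⟩ := happ.exists
  choose! x hx using hN
  let c : ℝ := (Fintype.card (Fin (N + 1)) : ℝ) ^ (1 / p)
  have hc : c ≠ 0 := (Real.rpow_pos_of_pos (by simp; positivity) _).ne'
  -- Dividing by `c` beforehand cancels the dilation in `scaledUniform`.
  let y : WassersteinSpace p (ℝ × ℝ) → Fin (N + 1) → ℝ × ℝ := fun α i => c⁻¹ • x α i
  have hxy : ∀ α, (scaledUniform hp (y α)).1 = uniformMeasure (x α) := fun α => by
    change uniformMeasure (fun i => c • c⁻¹ • x α i) = _
    simp only [smul_inv_smul₀ hc]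
  let R : ℝ := ∑ α ∈ F, ∑ i, ‖y α i‖
  have hR : ∀ α ∈ F, ∀ i, ‖y α i‖ ≤ R := fun α hα i =>
    (Finset.single_le_sum (f := fun i => ‖y α i‖) (fun _ _ => norm_nonneg _)
      (Finset.mem_univ i)).trans
    (Finset.single_le_sum (f := fun α => ∑ i, ‖y α i‖)
      (fun _ _ => Finset.sum_nonneg fun _ _ => norm_nonneg _) hα)
  refine ⟨fun α => liftedDiagram (6 * R + 1) (y α), fun α hα β hβ => ?_⟩
  rw [wassersteinDist_liftedDiagram hp (hR α hα) (hR β hβ), ← ENNReal.coe_le_coe,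
    ← ENNReal.coe_le_coe, ENNReal.coe_add, ENNReal.coe_add, coe_wassersteinDist hp,
    coe_wassersteinDist hp, hxy, hxy]
  have hα' := hx α hα
  have hβ' := hx β hβ
  have htwo : ((2 : ℝ≥0) : ℝ≥0∞) = 1 + 1 := by norm_num
  rw [htwo]
  constructor
  · refine (wassersteinEDist_triangle (β := uniformMeasure (x α)) hp).trans ?_
    refine (add_le_add hα' (wassersteinEDist_triangle (β := uniformMeasure (x β)) hp)).trans ?_
    rw [wassersteinEDist_comm hp (α := uniformMeasure (x β))]
    calc _ ≤ 1 + (wassersteinEDist p (uniformMeasure (x α)) (uniformMeasure (x β)) + 1) := by gcongr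
      _ = _ := by ring
  · refine (wassersteinEDist_triangle (β := α.1) hp).trans ?_
    refine (add_le_add_right (wassersteinEDist_triangle (β := β.1) hp) _).trans ?_
    rw [wassersteinEDist_comm hp (α := uniformMeasure (x α))]
    calc _ ≤ 1 + (wassersteinEDist p α.1 β.1 + 1) := by gcongr
      _ = _ := by ring

end

theorem theorem5p1 (p : ℝ) (hp : 1 ≤ p) :
    CoarselyEmbedsIntoHilbert (PersistenceDiagram.wassersteinDist p) ↔
      CoarselyEmbedsIntoHilbert
        (fun α β : WassersteinSpace p (ℝ × ℝ) => WassersteinSpace.wassersteinDist p α β) := by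
  constructor
  · intro h
    -- The subtraction is truncated at `0`, which keeps the lower control in `ℝ≥0` and still
    -- unbounded.
    refine h.of_forall_finset (fun t => t - 2) (fun t => t + 2)
      (fun _ _ h => tsub_le_tsub_right h 2) (fun _ _ h => add_le_add_left h 2) ?_ fun F => ?_
    · refine tendsto_atTop.2 fun b => ?_
      filter_upwards [eventually_ge_atTop (b + 2)] with t ht using le_tsub_of_add_le_right ht
    · obtain ⟨φ, hφ⟩ := exists_map_wassersteinSpace_persistenceDiagram hp F
      exact ⟨φ, fun α hα β hβ => ⟨tsub_le_iff_right.2 (hφ α hα β hβ).1, (hφ α hα β hβ).2⟩⟩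
  · intro h
    exact h.of_forall_finset id (fun t => 2 * t) monotone_id
      (fun _ _ h => mul_le_mul_right h 2) tendsto_id
      fun F => exists_map_persistenceDiagram_wassersteinSpace hp F
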